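/- Let $\mathbb T=\mathbb R/\mathbb Z$, identified with $[0,1)$ where coordinates are used, and let $a\in(0,1)$. Let $\tau:\mathbb T\to\mathbb T$, $\tau(\xi)=a^{-1}\xi$ for $\xi\in[0,a)$ and $\tau(\xi)=(1-a)^{-1}(\xi-a)$ for $\xi\in[a,1)$, with slope $\tau'=a^{-1}$ on $[0,a)$ and $\tau'=(1-a)^{-1}$ on $[a,1)$. Let $T:\mathbb T^2\to\mathbb T^2$ be the generalized baker map, $T(\xi,x)=(\tau(\xi),ax)$ if $\xi\in[0,a)$ and $T(\xi,x)=(\tau(\xi),a+(1-a)x)$ if $\xi\in[a,1)$; the coordinate $x$ is called the stable coordinate. Let $(f_x)_{x\in\mathbb T}$ be a family of $C^3$ maps $f_x:\mathbb R\to\mathbb R$ such that - the $f_x$ are uniformly bounded, $f_x'>0$, and the Schwarzian derivative $\mathcal S f_x=\frac{f_x'''}{f_x'}-\frac32\left(\frac{f_x''}{f_x'}\right)^2$ is negative everywhere; - $(x,y)\mapsto f_x(y)$ is continuous on $\mathbb T\times\mathbb R$; - there are non-empty compact intervals $I\subseteq J^\circ\subseteq J$ with $f_x(J)\subseteq I^\circ$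 for all $x\in\mathbb T$ and $\inf_{(x,y)\in\mathbb T\times J}\tau'(x)\,f_{\tau(x)}'(y)>1$; - $(x,y)\mapsto f_x(y)$ is of class $C^2$ on $\mathbb T\times J$. Let $f(\xi,x,y)=(T(\xi,x),f_x(y))$ on $\mathbb T^2\times\mathbb R$, let $\mathrm{GA}=\bigcap_{n\ge0}f^n(\mathbb T^2\times\mathbb R)$ be its global attractor, and put $\varphi^+(\theta)=\sup\{y:(\theta,y)\in\mathrm{GA}\}$, $\varphi^-(\theta)=\inf\{y:(\theta,y)\in\mathrm{GA}\}$ for $\theta\in\mathbb T^2$. Let $P=\{\theta\in\mathbb T^2:\varphi^+(\theta)=\varphi^-(\theta)\}$ be the set of pinched points, and let $\mathcal P$ be the closure in $\mathbb T^2\times\mathbb R$ of $\{(\theta,\varphi^+(\theta)):\theta\in P\}$. Code $\theta\in\mathbb T^2$ by the sequence $(\omega_k(\theta))_{k\in\mathbb Z}\in\{0,1\}^{\mathbb Z}$, where $\omega_k(\theta)=0$ if and only if the first coordinate of $T^k\theta$ lies in $[0,a)$. A $T$-invariant Borel probability measure $\nu$ on $\mathbb T^2$ is called a Gibbs measure if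 there are constants $p\in\mathbb R$, $C>0$ and a function $\psi:\mathbb T^2\to\mathbb R$ that is Hölder continuous with respect to the coding (there are $C_0\in\mathbb R$ and $\rho\in(0,1)$ such that $|\psi(\theta)-\psi(\theta')|\le C_0\rho^n$ whenever $n\ge0$ and $\omega_k(\theta)=\omega_k(\theta')$ for $-n\le k<n$), with $$C^{-1}\le\frac{\nu\{\theta':\omega_k(\theta')=\omega_k(\theta)\text{ for }0\le k<n\}}{\exp\left(\sum_{k=0}^{n-1}\psi(T^k\theta)-np\right)}\le C\qquad\text{for all }n\ge0,\ \theta\in\mathbb T^2.$$ Theorem. If there exists a Gibbs measure $\nu$ with $\nu(P)=0$, then $\mathcal P=\emptyset$ or $\mathcal P$ is the graph of a function $\hat\varphi:\mathbb T^2\to\mathbb R$ of class $C^{1+\mathrm{Lip}}$ (its $\mathbb Z^2$-periodic lift to $\mathbb R^2$ is continuously differentiable with Lipschitz continuous derivative) that depends only on the stable coordinate, i.e. $\hat\varphi(\xi,x)=\hat\phi(x)$. -/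

import Mathlib

open Set

noncomputable section

/-- The representative in `[0, 1)` of a point of the circle `𝕋 = ℝ / ℤ`. -/
def circleCoord (x : UnitAddCircle) : ℝ := (AddCircle.equivIco (1 : ℝ) 0 x : ℝ)

/-- The piecewise linear expanding circle map `τ` with break point `a`. -/
def expandingMap (a : ℝ) (ξ : UnitAddCircle) : UnitAddCircle :=
  if circleCoord ξ < a then ((a⁻¹ * circleCoord ξ : ℝ) : UnitAddCircle)
  else (((1 - a)⁻¹ * (circleCoord ξ - a) : ℝ) : UnitAddCircle)

/-- The slope `τ'` of the expanding map (one-sided from the right at the break points). -/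
def expandingSlope (a : ℝ) (ξ : UnitAddCircle) : ℝ :=
  if circleCoord ξ < a then a⁻¹ else (1 - a)⁻¹

/-- The generalized baker map `T` of `𝕋²` with discontinuity at `a`; the second coordinate is
the contracted (stable) one. -/
def bakerMap (a : ℝ) (θ : UnitAddCircle × UnitAddCircle) : UnitAddCircle × UnitAddCircle :=
  (expandingMap a θ.1,
    if circleCoord θ.1 < a then ((a * circleCoord θ.2 : ℝ) : UnitAddCircle)
    else ((a + (1 - a) * circleCoord θ.2 : ℝ) : UnitAddCircle))

/-- The skew product `f(ξ, x, y) = (T(ξ, x), f_x(y))` over the baker map. -/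
def skewProduct (a : ℝ) (f : UnitAddCircle → ℝ → ℝ)
    (p : (UnitAddCircle × UnitAddCircle) × ℝ) : (UnitAddCircle × UnitAddCircle) × ℝ :=
  (bakerMap a p.1, f p.1.2 p.2)

/-- The Schwarzian derivative `g'''/g' - (3/2) (g''/g')²`. -/
def schwarzian (g : ℝ → ℝ) (y : ℝ) : ℝ :=
  iteratedDeriv 3 g y / deriv g y - 3 / 2 * (iteratedDeriv 2 g y / deriv g y) ^ 2

/-- The assumptions on the driven system: break point `a ∈ (0,1)`; uniformly bounded increasing
`C³` fibre maps with negative Schwarzian derivative, depending continuously on `x ∈ 𝕋`; compact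
intervals `I = [s, t]` and `J = [s', t']` with `I ⊆ J°` and `f(𝕋² × J) ⊆ 𝕋² × I°`; uniform partial
hyperbolicity over `J`; and `C²` regularity on `𝕋 × J`. -/
structure IsBakerDrivenSystem (a : ℝ) (f : UnitAddCircle → ℝ → ℝ) (s t s' t' : ℝ) : Prop where
  a_pos : 0 < a
  a_lt_one : a < 1
  contDiff_fibre : ∀ x, ContDiff ℝ 3 (f x)
  bounded : ∃ M : ℝ, ∀ x y, |f x y| ≤ M
  deriv_pos : ∀ x y, 0 < deriv (f x) y
  schwarzian_neg : ∀ x y, schwarzian (f x) y < 0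
  continuous_family : Continuous (fun p : UnitAddCircle × ℝ => f p.1 p.2)
  nonempty_I : s ≤ t
  I_subset : Icc s t ⊆ interior (Icc s' t')
  mapsTo : ∀ x, ∀ y ∈ Icc s' t', f x y ∈ interior (Icc s t)
  /-- The infimum of `τ'(x) f'_{τ(x)}(y)` over `𝕋 × J` is larger than `1`. -/
  hyperbolic : ∃ c : ℝ, 1 < c ∧ ∀ x, ∀ y ∈ Icc s' t',
    c ≤ expandingSlope a x * deriv (f (expandingMap a x)) y
  contDiff_joint : ContDiffOn ℝ 2 (fun p : ℝ × ℝ => f (p.1 : UnitAddCircle) p.2)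
    (univ ×ˢ Icc s' t')

/-- The global attractor `⋂ₙ fⁿ(𝕋² × ℝ)`. -/
def globalAttractor (a : ℝ) (f : UnitAddCircle → ℝ → ℝ) :
    Set ((UnitAddCircle × UnitAddCircle) × ℝ) :=
  ⋂ n : ℕ, range (skewProduct a f)^[n]

/-- The upper bounding graph `φ⁺` of the global attractor. -/
def phiPlus (a : ℝ) (f : UnitAddCircle → ℝ → ℝ) (θ : UnitAddCircle × UnitAddCircle) : ℝ :=
  sSup {y | (θ, y) ∈ globalAttractor a f}

/-- The lower bounding graph `φ⁻` of the global attractor. -/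
def phiMinus (a : ℝ) (f : UnitAddCircle → ℝ → ℝ) (θ : UnitAddCircle × UnitAddCircle) : ℝ :=
  sInf {y | (θ, y) ∈ globalAttractor a f}

/-- The set `P` of pinched points. -/
def pinchedSet (a : ℝ) (f : UnitAddCircle → ℝ → ℝ) : Set (UnitAddCircle × UnitAddCircle) :=
  {θ | phiPlus a f θ = phiMinus a f θ}

/-- The set `𝒫`: the closure of the graph of `φ⁺|_P = φ⁻|_P`. -/
def pinchedGraphClosure (a : ℝ) (f : UnitAddCircle → ℝ → ℝ) :
    Set ((UnitAddCircle × UnitAddCircle) × ℝ) :=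
  closure ((pinchedSet a f).graphOn (phiPlus a f))

/-- The first `n` symbols of the `τ`-itineraries of `ξ` and `ξ'` with respect to the partition
`{[0, a), [a, 1)}` agree. -/
def SameItinerary (a : ℝ) (n : ℕ) (ξ ξ' : UnitAddCircle) : Prop :=
  ∀ i < n, circleCoord ((expandingMap a)^[i] ξ) < a ↔ circleCoord ((expandingMap a)^[i] ξ') < a

/-- Hölder continuity of a potential with respect to the symbolic metric of the two-sided shift
that codes `T`. The symbols of `(ξ, x)` at times `0, 1, 2, …` form the `τ`-itinerary of `ξ`, those
at times `-1, -2, …` form the `τ`-itinerary of `x`. -/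
def IsSymbolicHolder (a : ℝ) (ψ : UnitAddCircle × UnitAddCircle → ℝ) : Prop :=
  ∃ C ρ : ℝ, 0 < ρ ∧ ρ < 1 ∧ ∀ (n : ℕ) (θ θ' : UnitAddCircle × UnitAddCircle),
    SameItinerary a n θ.1 θ'.1 → SameItinerary a n θ.2 θ'.2 → |ψ θ - ψ θ'| ≤ C * ρ ^ n

/-- The `n`-cylinder of `θ`: the points whose symbols at times `0, …, n - 1` are those of `θ`. -/
def forwardCylinder (a : ℝ) (n : ℕ) (θ : UnitAddCircle × UnitAddCircle) :
    Set (UnitAddCircle × UnitAddCircle) :=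
  {θ' | SameItinerary a n θ.1 θ'.1}

/-- Gibbs measures (in the sense of Bowen) for the baker map: `T`-invariant probability measures
`ν` such that, for some Hölder potential `ψ` and some constant `p` (the pressure), the measure of
each `n`-cylinder is comparable to `exp (Sₙψ(θ) - n p)`, uniformly in `n` and in its points `θ`. -/
structure IsGibbsMeasure (a : ℝ)
    (ν : MeasureTheory.Measure (UnitAddCircle × UnitAddCircle)) : Prop where
  isProbabilityMeasure : MeasureTheory.IsProbabilityMeasure ν
  invariant : MeasureTheory.MeasurePreserving (bakerMap a) ν ν
  gibbs : ∃ ψ : UnitAddCircle × UnitAddCircle → ℝ, IsSymbolicHolder a ψ ∧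
    ∃ p C : ℝ, 0 < C ∧ ∀ (n : ℕ) (θ : UnitAddCircle × UnitAddCircle),
      C⁻¹ * Real.exp (birkhoffSum (bakerMap a) ψ n θ - n * p) ≤ ν.real (forwardCylinder a n θ) ∧
      ν.real (forwardCylinder a n θ) ≤ C * Real.exp (birkhoffSum (bakerMap a) ψ n θ - n * p)

/-- `C^{1+Lip}` functions on `𝕋²`: the `ℤ²`-periodic lift to `ℝ²` is continuously differentiable
with Lipschitz continuous derivative. -/
def IsC1Lip (φ : UnitAddCircle × UnitAddCircle → ℝ) : Prop :=
  ContDiff ℝ 1 (fun p : ℝ × ℝ => φ ((p.1 : UnitAddCircle), (p.2 : UnitAddCircle))) ∧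
  ∃ K : NNReal, LipschitzWith K
    (fderiv ℝ (fun p : ℝ × ℝ => φ ((p.1 : UnitAddCircle), (p.2 : UnitAddCircle))))

end

/-! ### The circle, the expanding map and its inverse branches -/

/-! The stable coordinate of `T⁻¹θ` is `τ(x)`, so the attractor over `θ` is governed by the
compositions `pull` of fibre maps along `τⁿx, …, τx`. Its bounding graphs are functions `upper`,
`lower` of `x` alone, carried by `f` along the inverse branches of `τ`. Hence `P = 𝕋 × Q` with `Q =
{upper = lower}`, and `Q`, being invariant under the contracting inverse branches, is empty or
dense.

The crux is `exists_lipschitz_upper`: `upper` is Lipschitz on `Q`. By hyperbolicity, steep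
differences stay steep under the inverse branches (`exists_cone_invariant`). If two points of `Q`
violate the bound, semicontinuity spreads the violation to two small cylinders, and then `upper`
over the first stays below `lower` over the second along every common continuation `v`.
`not_forall_upper_lt_lower` excludes this. A long `v` brings the two points close together; a
definite gap `upper - lower` at the first then forces `pull k` to approximate `lower` badly at the
second. So for each `v` one of the two cylinders consists of nearly pinched or badly approximated
points. The Gibbs property bounds the measure of the union of these cylinders below
(`exists_le_measureReal`), while `ν(P) = 0` makes it arbitrarily small.

For smoothness, a Lipschitz extension `g` of `upper` from `Q` satisfies `g(ar) = f_r(g(r))` on `[0,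
1]`, with fibre derivative at least `ca`, `c > 1`. Differences of difference quotients therefore
contract, which gives a derivative with quadratic remainder
(`exists_derivative_of_functional_equation`). The equations of both branches at the ends of `[0, 1]`
make the one-sided derivatives agree, so the periodic extension is `C^{1+Lip}`. -/

theorem circleCoord_nonneg (x : UnitAddCircle) : 0 ≤ circleCoord x :=
  (AddCircle.equivIco (1 : ℝ) 0 x).2.1

theorem circleCoord_lt_one (x : UnitAddCircle) : circleCoord x < 1 :=
  (AddCircle.equivIco (1 : ℝ) 0 x).2.2.trans_eq (zero_add 1)

@[simp] theorem coe_circleCoord (x : UnitAddCircle) : (circleCoord x : UnitAddCircle) = x :=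
  AddCircle.coe_equivIco

theorem circleCoord_coe {r : ℝ} (h0 : 0 ≤ r) (h1 : r < 1) :
    circleCoord (r : UnitAddCircle) = r :=
  AddCircle.equivIco_coe_of_mem (p := (1 : ℝ)) (a := 0) ⟨h0, by simpa using h1⟩

theorem circleCoord_coe_eq_fract (r : ℝ) : circleCoord (r : UnitAddCircle) = Int.fract r := by
  rw [← AddCircle.coe_fract r, circleCoord_coe (Int.fract_nonneg r) (Int.fract_lt_one r)]

theorem measurable_circleCoord : Measurable circleCoord :=
  measurable_subtype_coe.comp (AddCircle.measurableEquivIco (1 : ℝ) 0).measurable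

theorem dist_le_abs_circleCoord_sub (x y : UnitAddCircle) :
    dist x y ≤ |circleCoord x - circleCoord y| := by
  conv_lhs => rw [← coe_circleCoord x, ← coe_circleCoord y]
  rw [dist_eq_norm, ← AddCircle.coe_sub, ← Real.norm_eq_abs]
  exact QuotientAddGroup.norm_mk_le_norm

/-- A continuous real function with equal values at `0` and `1`, read in the coordinate. -/
theorem continuous_comp_circleCoord {B : Type*} [TopologicalSpace B] {h : ℝ → B}
    (h01 : h 0 = h 1) (hc : ContinuousOn h (Icc 0 1)) :
    Continuous fun x : UnitAddCircle => h (circleCoord x) :=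
  AddCircle.liftIco_zero_continuous (p := (1 : ℝ)) h01 hc

theorem expandingMap_continuous {a : ℝ} (h0 : 0 < a) (h1 : a < 1) :
    Continuous (expandingMap a) := by
  have hb : (0 : ℝ) < 1 - a := by linarith
  -- One continuous formula for both pieces: beyond `a` the first summand is saturated at `1`, which
  -- vanishes in the circle.
  let h : ℝ → UnitAddCircle := fun r => ((min (a⁻¹ * r) 1 + max ((1 - a)⁻¹ * (r - a)) 0 : ℝ))
  have hh : expandingMap a = fun x => h (circleCoord x) := by
    funext x
    simp only [expandingMap, h]
    split_ifs with hx
    · rw [min_eq_left, max_eq_right, add_zero]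
      · exact mul_nonpos_of_nonneg_of_nonpos (by positivity) (by linarith)
      · rw [inv_mul_le_iff₀ h0]; linarith
    · push Not at hx
      rw [min_eq_right, max_eq_left, AddCircle.coe_add, AddCircle.coe_period, zero_add]
      · exact mul_nonneg (by positivity) (by linarith)
      · rw [le_inv_mul_iff₀ h0]; linarith
  rw [hh]
  refine continuous_comp_circleCoord ?_ ?_
  · have e0 : (min (a⁻¹ * 0) 1 + max ((1 - a)⁻¹ * (0 - a)) 0 : ℝ) = 0 := by
      rw [mul_zero, min_eq_left zero_le_one, max_eq_right, add_zero]
      exact mul_nonpos_of_nonneg_of_nonpos (by positivity) (by linarith)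
    have e1 : (min (a⁻¹ * 1) 1 + max ((1 - a)⁻¹ * (1 - a)) 0 : ℝ) = 1 + 1 := by
      rw [inv_mul_cancel₀ hb.ne', mul_one, min_eq_right, max_eq_left zero_le_one]
      exact (one_le_inv₀ h0).2 h1.le
    simp only [h, e0, e1]
    rw [AddCircle.coe_add, AddCircle.coe_period, AddCircle.coe_zero, add_zero]
  · refine Continuous.continuousOn ?_
    exact (AddCircle.continuous_mk' (1 : ℝ)).comp (by fun_prop)

/-- The slope of an inverse branch of the expanding map. -/
noncomputable def branchScale (a : ℝ) (b : Bool) : ℝ := if b then 1 - a else a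

/-- The left end point of the image of an inverse branch of the expanding map. -/
noncomputable def branchShift (a : ℝ) (b : Bool) : ℝ := if b then a else 0

/-- The inverse branches of the expanding map. -/
noncomputable def branch (a : ℝ) (b : Bool) (x : UnitAddCircle) : UnitAddCircle :=
  ((branchShift a b + branchScale a b * circleCoord x : ℝ) : UnitAddCircle)

/-- The symbol of a point of the circle. -/
noncomputable def letter (a : ℝ) (ξ : UnitAddCircle) : Bool :=
  if circleCoord ξ < a then false else true

/-- The first `n` symbols of a point of the circle. -/
noncomputable def word (a : ℝ) : ℕ → UnitAddCircle → List Bool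
  | 0, _ => []
  | n + 1, ξ => letter a ξ :: word a n (expandingMap a ξ)

/-- The composition of inverse branches along a word, the first symbol being applied first. -/
noncomputable def branches (a : ℝ) : List Bool → UnitAddCircle → UnitAddCircle
  | [], x => x
  | b :: w, x => branches a w (branch a b x)

section

variable {a : ℝ} (h0 : 0 < a) (h1 : a < 1)

include h0 h1

theorem branchScale_pos (b : Bool) : 0 < branchScale a b := by
  cases b <;> simp [branchScale] <;> linarith

omit h0 h1 in
theorem branchScale_le_max (b : Bool) : branchScale a b ≤ max a (1 - a) := by
  cases b <;> simp [branchScale]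

omit h0 h1 in
theorem min_le_branchScale (b : Bool) : min a (1 - a) ≤ branchScale a b := by
  cases b <;> simp [branchScale]

omit h1 in
theorem branchShift_nonneg (b : Bool) : 0 ≤ branchShift a b := by
  cases b <;> simp [branchShift]; linarith

omit h0 in
theorem branchShift_add_branchScale_le (b : Bool) : branchShift a b + branchScale a b ≤ 1 := by
  cases b <;> simp [branchShift, branchScale]; linarith

theorem circleCoord_branch (b : Bool) (x : UnitAddCircle) :
    circleCoord (branch a b x) = branchShift a b + branchScale a b * circleCoord x := by
  have hs := branchScale_pos h0 h1 b
  have := branchShift_nonneg h0 b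
  have := branchShift_add_branchScale_le h1 b
  have := circleCoord_nonneg x
  have := circleCoord_lt_one x
  refine circleCoord_coe (by positivity) ?_
  nlinarith

theorem letter_branch (b : Bool) (x : UnitAddCircle) : letter a (branch a b x) = b := by
  have hx0 := circleCoord_nonneg x
  have hx1 := circleCoord_lt_one x
  unfold letter
  rw [circleCoord_branch h0 h1]
  cases b
  · have : a * circleCoord x < a := by nlinarith
    simp [branchShift, branchScale, this]
  · have : 0 ≤ (1 - a) * circleCoord x := mul_nonneg (by linarith) hx0
    simp [branchShift, branchScale, this]

omit h0 h1 in
theorem circleCoord_lt_of_letter_false {ξ : UnitAddCircle} :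
    letter a ξ = false ↔ circleCoord ξ < a := by
  unfold letter; split_ifs <;> simp_all

theorem expandingMap_branch (b : Bool) (x : UnitAddCircle) :
    expandingMap a (branch a b x) = x := by
  have hl := letter_branch h0 h1 b x
  have hc := circleCoord_branch h0 h1 b x
  have hb : (1 - a) ≠ 0 := by linarith
  unfold expandingMap
  cases b
  · rw [circleCoord_lt_of_letter_false] at hl
    rw [if_pos hl, hc]
    simp [branchShift, branchScale, h0.ne']
  · have hl' : ¬ circleCoord (branch a true x) < a := by
      rw [← circleCoord_lt_of_letter_false, hl]; simp
    rw [if_neg hl', hc]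
    simp [branchShift, branchScale, hb]

theorem branch_expandingMap (x : UnitAddCircle) :
    branch a (letter a x) (expandingMap a x) = x := by
  have hb : (0 : ℝ) < 1 - a := by linarith
  have hx0 := circleCoord_nonneg x
  have hx1 := circleCoord_lt_one x
  conv_rhs => rw [← coe_circleCoord x]
  unfold branch letter expandingMap
  congr 1
  split_ifs with hx
  · rw [circleCoord_coe (by positivity) (by rw [inv_mul_lt_iff₀ h0]; linarith)]
    simp [branchShift, branchScale, h0.ne']
  · push Not at hx
    rw [circleCoord_coe (mul_nonneg (by positivity) (by linarith))
      (by rw [inv_mul_lt_iff₀ hb]; linarith)]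
    simp [branchShift, branchScale, hb.ne']

theorem expandingSlope_branch (b : Bool) (x : UnitAddCircle) :
    expandingSlope a (branch a b x) = (branchScale a b)⁻¹ := by
  have hl := letter_branch h0 h1 b x
  unfold expandingSlope
  cases b
  · rw [circleCoord_lt_of_letter_false] at hl
    rw [if_pos hl]; simp [branchScale]
  · rw [if_neg]
    · simp [branchScale]
    · rw [← circleCoord_lt_of_letter_false, hl]; simp

omit h0 h1 in
theorem bakerMap_eq (θ : UnitAddCircle × UnitAddCircle) :
    bakerMap a θ = (expandingMap a θ.1, branch a (letter a θ.1) θ.2) := by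
  unfold bakerMap letter
  split_ifs <;> simp [branch, branchShift, branchScale]

omit h0 h1 in
theorem branches_append (v w : List Bool) (x : UnitAddCircle) :
    branches a (v ++ w) x = branches a w (branches a v x) := by
  induction v generalizing x with
  | nil => rfl
  | cons b v ih => simp [branches, ih]

omit h0 h1 in
-- The symbols read off `ξ` select the branches applied to `x`; this turns statements about forward
-- cylinders into statements about stable coordinates.
theorem bakerMap_iterate (n : ℕ) (θ : UnitAddCircle × UnitAddCircle) :
    (bakerMap a)^[n] θ = ((expandingMap a)^[n] θ.1, branches a (word a n θ.1) θ.2) := by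
  induction n generalizing θ with
  | zero => rfl
  | succ n ih =>
    rw [Function.iterate_succ_apply, ih, bakerMap_eq]
    rfl

omit h0 h1 in
theorem length_word (n : ℕ) (ξ : UnitAddCircle) : (word a n ξ).length = n := by
  induction n generalizing ξ with
  | zero => rfl
  | succ n ih => simp [word, ih]

omit h0 h1 in
theorem word_add (m n : ℕ) (ξ : UnitAddCircle) :
    word a (m + n) ξ = word a m ξ ++ word a n ((expandingMap a)^[m] ξ) := by
  induction m generalizing ξ with
  | zero => simp [word]
  | succ m ih =>
    rw [Nat.succ_add, word, ih, word]
    rfl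

omit h0 h1 in
theorem sameItinerary_iff (n : ℕ) (ξ ξ' : UnitAddCircle) :
    SameItinerary a n ξ ξ' ↔ word a n ξ = word a n ξ' := by
  induction n generalizing ξ ξ' with
  | zero => simp [SameItinerary, word]
  | succ n ih =>
    have hl : letter a ξ = letter a ξ' ↔ (circleCoord ξ < a ↔ circleCoord ξ' < a) := by
      unfold letter; split_ifs <;> simp [*]
    rw [word, word, List.cons.injEq, ← ih, hl]
    constructor
    · intro h
      exact ⟨h 0 n.succ_pos, fun i hi => h (i + 1) (by omega)⟩
    · rintro ⟨hz, hs⟩ i hi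
      cases i with
      | zero => exact hz
      | succ i => exact hs i (by omega)

theorem exists_word_eq (w : List Bool) : ∃ ξ, word a w.length ξ = w := by
  induction w with
  | nil => exact ⟨0, rfl⟩
  | cons b w ih =>
    obtain ⟨ξ, hξ⟩ := ih
    refine ⟨branch a b ξ, ?_⟩
    rw [List.length_cons, word, letter_branch h0 h1, expandingMap_branch h0 h1, hξ]

/-- The word is the `τ`-itinerary of `x` reversed. With the contraction of `branches`, every point
lies in arbitrarily short images of words of prescribed length. -/
theorem exists_branches_eq (m : ℕ) (x : UnitAddCircle) :
    ∃ w : List Bool, w.length = m ∧ ∃ z, branches a w z = x := by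
  induction m generalizing x with
  | zero => exact ⟨[], rfl, x, rfl⟩
  | succ m ih =>
    obtain ⟨w, hw, z, hz⟩ := ih (expandingMap a x)
    refine ⟨w ++ [letter a x], by simp [hw], z, ?_⟩
    rw [branches_append, hz]
    exact branch_expandingMap h0 h1 x

theorem abs_circleCoord_branches_sub_le (w : List Bool) (x y : UnitAddCircle) :
    |circleCoord (branches a w x) - circleCoord (branches a w y)| ≤ max a (1 - a) ^ w.length := by
  suffices h : |circleCoord (branches a w x) - circleCoord (branches a w y)| ≤
      max a (1 - a) ^ w.length * |circleCoord x - circleCoord y| by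
    refine h.trans (mul_le_of_le_one_right (pow_nonneg (h0.le.trans (le_max_left _ _)) _) ?_)
    rw [abs_le]
    have := circleCoord_nonneg x
    have := circleCoord_nonneg y
    have := circleCoord_lt_one x
    have := circleCoord_lt_one y
    constructor <;> linarith
  induction w generalizing x y with
  | nil => simp [branches]
  | cons b w ih =>
    refine (ih _ _).trans ?_
    rw [circleCoord_branch h0 h1, circleCoord_branch h0 h1, List.length_cons, pow_succ, mul_assoc,
      add_sub_add_left_eq_sub, ← mul_sub, abs_mul, abs_of_pos (branchScale_pos h0 h1 b)]
    have := branchScale_le_max (a := a) b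
    have hm : 0 ≤ max a (1 - a) := h0.le.trans (le_max_left _ _)
    gcongr

theorem exists_max_pow_lt {ε : ℝ} (hε : 0 < ε) : ∃ N, ∀ n ≥ N, max a (1 - a) ^ n < ε := by
  have := tendsto_pow_atTop_nhds_zero_of_lt_one (h0.le.trans (le_max_left a (1 - a)))
    (max_lt h1 (by linarith))
  exact Filter.eventually_atTop.1 (this.eventually (gt_mem_nhds hε))

omit h0 h1 in
theorem measurable_letter : Measurable (letter a) :=
  Measurable.ite (measurableSet_lt measurable_circleCoord measurable_const)
    measurable_const measurable_const

theorem measurableSet_word (n : ℕ) (w : List Bool) : MeasurableSet {ξ | word a n ξ = w} := by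
  induction n generalizing w with
  | zero => simp [word]
  | succ n ih =>
    cases w with
    | nil => simp [word]
    | cons b w =>
      have : {ξ | word a (n + 1) ξ = b :: w} =
          letter a ⁻¹' {b} ∩ expandingMap a ⁻¹' {ξ | word a n ξ = w} := by
        ext ξ; simp [word]
      rw [this]
      exact (measurable_letter (measurableSet_singleton b)).inter
        ((expandingMap_continuous h0 h1).measurable (ih w))

end

/-! ### The bounding graphs of the global attractor -/

/-- The composition of the fibre maps along the backward orbit of length `n` of `x`. -/
noncomputable def pull (a : ℝ) (f : UnitAddCircle → ℝ → ℝ) : ℕ → UnitAddCircle → ℝ → ℝ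
  | 0, _, y => y
  | n + 1, x, y => f (expandingMap a x) (pull a f n (expandingMap a x) y)

/-- The upper bounding graph as a function of the stable coordinate. -/
noncomputable def upper (a : ℝ) (f : UnitAddCircle → ℝ → ℝ) (M : ℝ) (x : UnitAddCircle) : ℝ :=
  ⨅ n, pull a f n x M

/-- The lower bounding graph as a function of the stable coordinate. -/
noncomputable def lower (a : ℝ) (f : UnitAddCircle → ℝ → ℝ) (M : ℝ) (x : UnitAddCircle) : ℝ :=
  ⨆ n, pull a f n x (-M)

/-- Splits off the innermost map instead of the outermost; its value lies in `[-M, M]`, which yields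
the monotonicity in `n`. -/
theorem pull_succ_eq (a : ℝ) (f : UnitAddCircle → ℝ → ℝ) (n : ℕ) (x : UnitAddCircle) (y : ℝ) :
    pull a f (n + 1) x y = pull a f n x (f ((expandingMap a)^[n + 1] x) y) := by
  induction n generalizing x with
  | zero => rfl
  | succ n ih => rw [pull, ih]; rfl

namespace IsBakerDrivenSystem

variable {a : ℝ} {f : UnitAddCircle → ℝ → ℝ} {s t s' t' : ℝ}
  (hf : IsBakerDrivenSystem a f s t s' t')

include hf

theorem strictMono_fibre (x : UnitAddCircle) : StrictMono (f x) :=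
  strictMono_of_deriv_pos (hf.deriv_pos x)

theorem strictMono_pull (n : ℕ) (x : UnitAddCircle) : StrictMono (pull a f n x) := by
  induction n generalizing x with
  | zero => exact strictMono_id
  | succ n ih => exact (hf.strictMono_fibre _).comp (ih _)

theorem continuous_pull (n : ℕ) :
    Continuous fun p : UnitAddCircle × ℝ => pull a f n p.1 p.2 := by
  have hτ := expandingMap_continuous hf.a_pos hf.a_lt_one
  induction n with
  | zero => exact continuous_snd
  | succ n ih =>
    exact hf.continuous_family.comp ((hτ.comp continuous_fst).prodMk
      (ih.comp ((hτ.comp continuous_fst).prodMk continuous_snd)))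

theorem continuous_pull_left (n : ℕ) (y : ℝ) : Continuous fun x => pull a f n x y :=
  (hf.continuous_pull n).comp (continuous_id.prodMk continuous_const)

theorem continuous_pull_right (n : ℕ) (x : UnitAddCircle) : Continuous (pull a f n x) :=
  (hf.continuous_pull n).comp (continuous_const.prodMk continuous_id)

variable {M : ℝ} (hM : ∀ x y, |f x y| ≤ M)

include hM

theorem pull_succ_le (n : ℕ) (x : UnitAddCircle) (y : ℝ) :
    pull a f (n + 1) x y ≤ pull a f n x M := by
  rw [pull_succ_eq]
  exact (hf.strictMono_pull n x).monotone (abs_le.1 (hM _ _)).2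

theorem le_pull_succ (n : ℕ) (x : UnitAddCircle) (y : ℝ) :
    pull a f n x (-M) ≤ pull a f (n + 1) x y := by
  rw [pull_succ_eq]
  exact (hf.strictMono_pull n x).monotone (abs_le.1 (hM _ _)).1

theorem antitone_pull (x : UnitAddCircle) : Antitone fun n => pull a f n x M :=
  antitone_nat_of_succ_le fun n => hf.pull_succ_le hM n x M

theorem monotone_pull (x : UnitAddCircle) : Monotone fun n => pull a f n x (-M) :=
  monotone_nat_of_le_succ fun n => hf.le_pull_succ hM n x (-M)

theorem pull_neg_le_pull (m n : ℕ) (x : UnitAddCircle) :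
    pull a f m x (-M) ≤ pull a f n x M := by
  have h0 : -M ≤ M := by linarith [abs_nonneg (f x 0), hM x 0]
  calc pull a f m x (-M) ≤ pull a f (max m n) x (-M) := hf.monotone_pull hM x (le_max_left _ _)
    _ ≤ pull a f (max m n) x M := (hf.strictMono_pull _ x).monotone h0
    _ ≤ pull a f n x M := hf.antitone_pull hM x (le_max_right _ _)

theorem bddBelow_pull (x : UnitAddCircle) : BddBelow (range fun n => pull a f n x M) :=
  ⟨pull a f 0 x (-M), by rintro _ ⟨n, rfl⟩; exact hf.pull_neg_le_pull hM 0 n x⟩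

theorem bddAbove_pull (x : UnitAddCircle) : BddAbove (range fun n => pull a f n x (-M)) :=
  ⟨pull a f 0 x M, by rintro _ ⟨n, rfl⟩; exact hf.pull_neg_le_pull hM n 0 x⟩

theorem upper_le_pull (n : ℕ) (x : UnitAddCircle) : upper a f M x ≤ pull a f n x M :=
  ciInf_le (hf.bddBelow_pull hM x) n

theorem pull_le_lower (n : ℕ) (x : UnitAddCircle) : pull a f n x (-M) ≤ lower a f M x :=
  le_ciSup (hf.bddAbove_pull hM x) n

theorem lower_le_upper (x : UnitAddCircle) : lower a f M x ≤ upper a f M x :=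
  ciSup_le fun m => le_ciInf fun n => hf.pull_neg_le_pull hM m n x

theorem tendsto_upper (x : UnitAddCircle) :
    Filter.Tendsto (fun n => pull a f n x M) Filter.atTop (nhds (upper a f M x)) :=
  tendsto_atTop_ciInf (hf.antitone_pull hM x) (hf.bddBelow_pull hM x)

theorem tendsto_lower (x : UnitAddCircle) :
    Filter.Tendsto (fun n => pull a f n x (-M)) Filter.atTop (nhds (lower a f M x)) :=
  tendsto_atTop_ciSup (hf.monotone_pull hM x) (hf.bddAbove_pull hM x)

/-- Invariance of the graph: `τ` sends both branch points back to `x`, so pulling one step further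
from them applies `f x` last. -/
theorem upper_branch (b : Bool) (x : UnitAddCircle) :
    upper a f M (branch a b x) = f x (upper a f M x) := by
  refine tendsto_nhds_unique
    ((hf.tendsto_upper hM (branch a b x)).comp (Filter.tendsto_add_atTop_nat 1)) ?_
  have : (fun n => pull a f n (branch a b x) M) ∘ (fun n => n + 1) =
      fun n => f x (pull a f n x M) := by
    funext n
    simp only [Function.comp, pull, expandingMap_branch hf.a_pos hf.a_lt_one]
  rw [this]
  exact ((hf.contDiff_fibre x).continuous.tendsto _).comp (hf.tendsto_upper hM x)

theorem lower_branch (b : Bool) (x : UnitAddCircle) :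
    lower a f M (branch a b x) = f x (lower a f M x) := by
  refine tendsto_nhds_unique
    ((hf.tendsto_lower hM (branch a b x)).comp (Filter.tendsto_add_atTop_nat 1)) ?_
  have : (fun n => pull a f n (branch a b x) (-M)) ∘ (fun n => n + 1) =
      fun n => f x (pull a f n x (-M)) := by
    funext n
    simp only [Function.comp, pull, expandingMap_branch hf.a_pos hf.a_lt_one]
  rw [this]
  exact ((hf.contDiff_fibre x).continuous.tendsto _).comp (hf.tendsto_lower hM x)

theorem upper_eq_lower_branches {x : UnitAddCircle} (hx : upper a f M x = lower a f M x)
    (w : List Bool) : upper a f M (branches a w x) = lower a f M (branches a w x) := by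
  induction w generalizing x with
  | nil => exact hx
  | cons b w ih =>
    refine ih ?_
    rw [hf.upper_branch hM, hf.lower_branch hM, hx]

theorem measurable_upper : Measurable (upper a f M) :=
  measurable_of_tendsto_metrizable (fun n => (hf.continuous_pull_left n M).measurable)
    (tendsto_pi_nhds.2 (hf.tendsto_upper hM))

theorem measurable_lower : Measurable (lower a f M) :=
  measurable_of_tendsto_metrizable (fun n => (hf.continuous_pull_left n (-M)).measurable)
    (tendsto_pi_nhds.2 (hf.tendsto_lower hM))

/-- An infimum of continuous functions is upper semicontinuous. -/
theorem eventually_upper_lt {x : UnitAddCircle} {r : ℝ} (h : upper a f M x < r) :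
    ∀ᶠ z in nhds x, upper a f M z < r := by
  obtain ⟨n, hn⟩ := exists_lt_of_ciInf_lt h
  filter_upwards [(hf.continuous_pull_left n M).tendsto x (gt_mem_nhds hn)] with z hz
  exact (hf.upper_le_pull hM n z).trans_lt hz

theorem eventually_lt_lower {x : UnitAddCircle} {r : ℝ} (h : r < lower a f M x) :
    ∀ᶠ z in nhds x, r < lower a f M z := by
  obtain ⟨n, hn⟩ := exists_lt_of_lt_ciSup h
  filter_upwards [(hf.continuous_pull_left n (-M)).tendsto x (lt_mem_nhds hn)] with z hz
  exact lt_of_lt_of_le hz (hf.pull_le_lower hM n z)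

omit hM in
-- The baker map is a bijection whose inverse acts on the stable coordinate as `τ`, so preimages are
-- found by following `τ` and are unrestricted in `ξ`.
theorem mem_range_skewProduct_iterate (n : ℕ) (ξ x : UnitAddCircle) (y : ℝ) :
    ((ξ, x), y) ∈ range (skewProduct a f)^[n] ↔ ∃ z, pull a f n x z = y := by
  have h0 := hf.a_pos
  have h1 := hf.a_lt_one
  induction n generalizing ξ x y with
  | zero => simp [pull]
  | succ n ih =>
    constructor
    · rintro ⟨p, hp⟩
      rw [Function.iterate_succ_apply'] at hp
      obtain ⟨⟨⟨ξ', x'⟩, y'⟩, hq⟩ : ∃ q, q = (skewProduct a f)^[n] p := ⟨_, rfl⟩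
      rw [← hq, skewProduct, bakerMap_eq] at hp
      simp only [Prod.mk.injEq] at hp
      obtain ⟨⟨-, hx⟩, hy⟩ := hp
      obtain ⟨z, hz⟩ := (ih ξ' x' y').1 ⟨p, hq.symm⟩
      have hτ : expandingMap a x = x' := by rw [← hx, expandingMap_branch h0 h1]
      exact ⟨z, by rw [pull, hτ, hz, hy]⟩
    · rintro ⟨z, hz⟩
      obtain ⟨p, hp⟩ := (ih (branch a (letter a x) ξ) (expandingMap a x)
        (pull a f n (expandingMap a x) z)).2 ⟨z, rfl⟩
      refine ⟨p, ?_⟩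
      rw [Function.iterate_succ_apply', hp, skewProduct, bakerMap_eq]
      simp only [expandingMap_branch h0 h1, letter_branch h0 h1, branch_expandingMap h0 h1]
      rw [← hz, pull]

theorem mem_globalAttractor_iff (θ : UnitAddCircle × UnitAddCircle) (y : ℝ) :
    (θ, y) ∈ globalAttractor a f ↔ y ∈ Icc (lower a f M θ.2) (upper a f M θ.2) := by
  obtain ⟨ξ, x⟩ := θ
  simp only [globalAttractor, mem_iInter, hf.mem_range_skewProduct_iterate]
  constructor
  · intro h
    -- Membership at time `n + 1` gives the bounds at time `n`: after one step any fibre point has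
    -- entered `[-M, M]`.
    refine ⟨ciSup_le fun n => ?_, le_ciInf fun n => ?_⟩ <;> obtain ⟨z, rfl⟩ := h (n + 1)
    · exact hf.le_pull_succ hM n x z
    · exact hf.pull_succ_le hM n x z
  · rintro ⟨hl, hu⟩ n
    have h0 : -M ≤ M := by linarith [abs_nonneg (f x 0), hM x 0]
    obtain ⟨z, -, hz⟩ := intermediate_value_Icc h0 (hf.continuous_pull_right n x).continuousOn
      ⟨(hf.pull_le_lower hM n x).trans hl, hu.trans (hf.upper_le_pull hM n x)⟩
    exact ⟨z, hz⟩

theorem phiPlus_eq (θ : UnitAddCircle × UnitAddCircle) : phiPlus a f θ = upper a f M θ.2 := by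
  simp only [phiPlus, hf.mem_globalAttractor_iff hM, ofPred_mem_eq]
  exact csSup_Icc (hf.lower_le_upper hM θ.2)

theorem phiMinus_eq (θ : UnitAddCircle × UnitAddCircle) : phiMinus a f θ = lower a f M θ.2 := by
  simp only [phiMinus, hf.mem_globalAttractor_iff hM, ofPred_mem_eq]
  exact csInf_Icc (hf.lower_le_upper hM θ.2)

theorem pinchedSet_eq :
    pinchedSet a f = {θ | upper a f M θ.2 = lower a f M θ.2} := by
  ext θ
  simp only [pinchedSet, mem_ofPred_eq, hf.phiPlus_eq hM, hf.phiMinus_eq hM]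

omit hM in
theorem I_subset_J : Icc s t ⊆ Icc s' t' := hf.I_subset.trans interior_subset

omit hM in
theorem lt_lt : s' < s ∧ t < t' := by
  have h := hf.I_subset
  rw [interior_Icc] at h
  exact ⟨(h (left_mem_Icc.2 hf.nonempty_I)).1, (h (right_mem_Icc.2 hf.nonempty_I)).2⟩

/-- Orbits started at `s` stay in `I` and are squeezed between the two bounding sequences, which
have the same limit at a pinched point. -/
theorem upper_mem_of_eq {x : UnitAddCircle} (hx : upper a f M x = lower a f M x) :
    upper a f M x ∈ Icc s t := by
  have hs : s ∈ Icc s' t' := hf.I_subset_J (left_mem_Icc.2 hf.nonempty_I)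
  have hpull : ∀ n z, pull a f n z s ∈ Icc s t := by
    intro n
    induction n with
    | zero => exact fun _ => left_mem_Icc.2 hf.nonempty_I
    | succ n ih => exact fun z => interior_subset (hf.mapsTo _ _ (hf.I_subset_J (ih _)))
  have hlim : Filter.Tendsto (fun n => pull a f (n + 1) x s) Filter.atTop
      (nhds (upper a f M x)) :=
    tendsto_of_tendsto_of_tendsto_of_le_of_le (hx ▸ hf.tendsto_lower hM x)
      (hf.tendsto_upper hM x) (fun n => hf.le_pull_succ hM n x s)
      (fun n => hf.pull_succ_le hM n x s)
  exact isClosed_Icc.mem_of_tendsto hlim (Filter.Eventually.of_forall fun n => hpull _ _)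

end IsBakerDrivenSystem

/-! ### Differential estimates for the fibre maps -/

/-- A `C²` function has, on compact convex subsets, a Taylor expansion of first order with
quadratic remainder, and it is Lipschitz there. -/
theorem ContDiffOn.exists_taylor_bound {E : Type*} [NormedAddCommGroup E] [NormedSpace ℝ E]
    {F : E → ℝ} {S S₀ : Set E} (hF : ContDiffOn ℝ 2 F S) (hS : UniqueDiffOn ℝ S)
    (hS₀ : IsCompact S₀) (hconv : Convex ℝ S₀) (hsub : S₀ ⊆ S) :
    ∃ K : ℝ, 0 ≤ K ∧ ∀ z ∈ S₀, ∀ z' ∈ S₀, |F z' - F z| ≤ K * ‖z' - z‖ ∧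
      |F z' - F z - fderivWithin ℝ F S z (z' - z)| ≤ K * ‖z' - z‖ ^ 2 := by
  have hD : ContDiffOn ℝ 1 (fderivWithin ℝ F S) S := hF.fderivWithin hS (by norm_num)
  have hFd : DifferentiableOn ℝ F S := hF.differentiableOn (by norm_num)
  have hDd : DifferentiableOn ℝ (fderivWithin ℝ F S) S := hD.differentiableOn (by norm_num)
  obtain ⟨K₁, hK₁⟩ := hS₀.exists_bound_of_continuousOn (hD.continuousOn.mono hsub)
  obtain ⟨K₂, hK₂⟩ := hS₀.exists_bound_of_continuousOn
    ((hD.continuousOn_fderivWithin hS (by norm_num)).mono hsub)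
  have hlip : ∀ z ∈ S₀, ∀ z' ∈ S₀, |F z' - F z| ≤ K₁ * ‖z' - z‖ := fun z hz z' hz' =>
    hconv.norm_image_sub_le_of_norm_hasFDerivWithin_le
      (fun w hw => ((hFd w (hsub hw)).hasFDerivWithinAt).mono hsub) hK₁ hz hz'
  have hDlip : ∀ z ∈ S₀, ∀ z' ∈ S₀,
      ‖fderivWithin ℝ F S z' - fderivWithin ℝ F S z‖ ≤ K₂ * ‖z' - z‖ := fun z hz z' hz' =>
    hconv.norm_image_sub_le_of_norm_hasFDerivWithin_le
      (fun w hw => ((hDd w (hsub hw)).hasFDerivWithinAt).mono hsub) hK₂ hz hz'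
  refine ⟨max K₁ K₂ ⊔ 0, le_max_right _ _, fun z hz z' hz' => ⟨?_, ?_⟩⟩
  · refine (hlip z hz z' hz').trans ?_
    gcongr
    exact (le_max_left _ _).trans (le_max_left _ _)
  · have hseg : segment ℝ z z' ⊆ S₀ := hconv.segment_subset hz hz'
    -- Mean value inequality on the segment for `F` minus its linear part at `z`, whose derivative
    -- there is at most a constant times `‖z' - z‖`.
    have := (convex_segment z z').norm_image_sub_le_of_norm_hasFDerivWithin_le'
      (f := F) (f' := fderivWithin ℝ F S) (φ := fderivWithin ℝ F S z)
      (C := (max K₁ K₂ ⊔ 0) * ‖z' - z‖)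
      (fun w hw => ((hFd w (hsub (hseg hw))).hasFDerivWithinAt).mono (hseg.trans hsub))
      (fun w hw => ?_) (left_mem_segment ℝ z z') (right_mem_segment ℝ z z')
    · rw [Real.norm_eq_abs] at this
      refine this.trans (le_of_eq (by ring))
    · refine (hDlip z hz w (hseg hw)).trans ?_
      have hw' : ‖w - z‖ ≤ ‖z' - z‖ := by
        rw [segment_eq_image'] at hw
        obtain ⟨θ, hθ, rfl⟩ := hw
        rw [add_sub_cancel_left, norm_smul, Real.norm_of_nonneg hθ.1]
        exact mul_le_of_le_one_left (norm_nonneg _) hθ.2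
      gcongr
      exact (le_max_right _ _).trans (le_max_left _ _)

namespace IsBakerDrivenSystem

variable {a : ℝ} {f : UnitAddCircle → ℝ → ℝ} {s t s' t' : ℝ}
  (hf : IsBakerDrivenSystem a f s t s' t')

include hf

theorem differentiable_fibre (x : UnitAddCircle) : Differentiable ℝ (f x) :=
  (hf.contDiff_fibre x).differentiable (by norm_num)

/-- Evaluating hyperbolicity at `branch a b x`, which `τ` maps to `x`, makes either slope available
at every `x`. -/
theorem exists_branchScale_le_deriv :
    ∃ c : ℝ, 1 < c ∧ ∀ b x, ∀ y ∈ Icc s' t', c * branchScale a b ≤ deriv (f x) y := by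
  obtain ⟨c, hc, h⟩ := hf.hyperbolic
  refine ⟨c, hc, fun b x y hy => ?_⟩
  have := h (branch a b x) y hy
  rwa [expandingSlope_branch hf.a_pos hf.a_lt_one, expandingMap_branch hf.a_pos hf.a_lt_one,
    ← div_eq_inv_mul, le_div_iff₀ (branchScale_pos hf.a_pos hf.a_lt_one b)] at this

/-- The first order Taylor expansion of the fibre maps over `J`, with quadratic remainder. -/
theorem exists_fibre_taylor : ∃ K : ℝ, 0 ≤ K ∧ ∃ A : ℝ → ℝ → ℝ,
    ∀ r ∈ Icc (-1 : ℝ) 1, ∀ r' ∈ Icc (-1 : ℝ) 1, ∀ y ∈ Icc s' t', ∀ y' ∈ Icc s' t',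
      |f (r' : UnitAddCircle) y - f (r : UnitAddCircle) y| ≤ K * |r' - r| ∧
      |f (r' : UnitAddCircle) y' - f (r : UnitAddCircle) y -
        (A r y * (r' - r) + deriv (f (r : UnitAddCircle)) y * (y' - y))| ≤
          K * (max |r' - r| |y' - y|) ^ 2 := by
  have hst : s' < t' := (hf.lt_lt.1.trans_le hf.nonempty_I).trans hf.lt_lt.2
  set S : Set (ℝ × ℝ) := univ ×ˢ Icc s' t' with hS
  set F : ℝ × ℝ → ℝ := fun p => f (p.1 : UnitAddCircle) p.2 with hF
  have hu : UniqueDiffOn ℝ S := uniqueDiffOn_univ.prod (uniqueDiffOn_Icc hst)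
  -- The base interval `[-1, 1]` lets a single expansion at `0` serve both sides of the point `0` of
  -- the circle, where the derivatives at the ends of `[0, 1]` are compared.
  obtain ⟨K, hK0, hK⟩ := hf.contDiff_joint.exists_taylor_bound hu
    (S₀ := Icc (-1 : ℝ) 1 ×ˢ Icc s' t') (isCompact_Icc.prod isCompact_Icc)
    ((convex_Icc _ _).prod (convex_Icc _ _)) (prod_mono (subset_univ _) subset_rfl)
  refine ⟨K, hK0, fun r y => fderivWithin ℝ F S (r, y) (1, 0),
    fun r hr r' hr' y hy y' hy' => ⟨?_, ?_⟩⟩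
  · have := (hK (r, y) ⟨hr, hy⟩ (r', y) ⟨hr', hy⟩).1
    simpa [Prod.norm_def] using this
  · have hd : fderivWithin ℝ F S (r, y) (0, 1) = deriv (f (r : UnitAddCircle)) y := by
      have h1 : HasFDerivWithinAt F (fderivWithin ℝ F S (r, y)) S (r, y) :=
        (hf.contDiff_joint.differentiableOn (by norm_num) (r, y)
          ⟨mem_univ _, hy⟩).hasFDerivWithinAt
      have h2 : HasDerivWithinAt (fun z : ℝ => ((r, z) : ℝ × ℝ)) (0, 1) (Icc s' t') y :=
        ((hasDerivAt_const y r).prodMk (hasDerivAt_id y)).hasDerivWithinAt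
      have h3 : HasDerivWithinAt (f (r : UnitAddCircle)) (fderivWithin ℝ F S (r, y) (0, 1))
          (Icc s' t') y :=
        h1.comp_hasDerivWithinAt y h2 fun z hz => ⟨mem_univ _, hz⟩
      exact (uniqueDiffOn_Icc hst y hy).eq_deriv _ h3
        (hf.differentiable_fibre _ y).hasDerivAt.hasDerivWithinAt
    have h4 : fderivWithin ℝ F S (r, y) ((r', y') - (r, y)) =
        fderivWithin ℝ F S (r, y) (1, 0) * (r' - r) +
          deriv (f (r : UnitAddCircle)) y * (y' - y) := by
      have : ((r', y') - (r, y) : ℝ × ℝ) =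
          (r' - r) • ((1, 0) : ℝ × ℝ) + (y' - y) • ((0, 1) : ℝ × ℝ) := by ext <;> simp
      rw [this, map_add, map_smul, map_smul, hd, smul_eq_mul, smul_eq_mul]
      ring
    rw [← h4]
    simpa [Prod.norm_def] using (hK (r, y) ⟨hr, hy⟩ (r', y') ⟨hr', hy'⟩).2

/-- Steep differences of points over `J` stay steep under the inverse branches of the
expanding map. -/
theorem exists_cone_invariant : ∃ L : ℝ, 0 ≤ L ∧ ∀ (b : Bool) (u₀ u₁ : UnitAddCircle),
    ∀ y₀ ∈ Icc s' t', ∀ y₁ ∈ Icc s' t', L * |circleCoord u₁ - circleCoord u₀| < y₁ - y₀ →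
      L * |circleCoord (branch a b u₁) - circleCoord (branch a b u₀)| < f u₁ y₁ - f u₀ y₀ := by
  have h0 := hf.a_pos
  have h1 := hf.a_lt_one
  obtain ⟨c, hc, hd⟩ := hf.exists_branchScale_le_deriv
  obtain ⟨K, hK0, A, hK⟩ := hf.exists_fibre_taylor
  have hm : 0 < min a (1 - a) := lt_min h0 (by linarith)
  -- Chosen so that `K ≤ (c - 1) * branchScale a b * L`: the excess expansion in the fibre absorbs
  -- the variation of `f` in the base.
  set L := K / ((c - 1) * min a (1 - a)) with hL
  have hden : 0 < (c - 1) * min a (1 - a) := mul_pos (by linarith) hm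
  have hL0 : 0 ≤ L := by positivity
  refine ⟨L, hL0, fun b u₀ u₁ y₀ hy₀ y₁ hy₁ h => ?_⟩
  have hb := branchScale_pos h0 h1 b
  have hsub : ∀ u : UnitAddCircle, circleCoord u ∈ Icc (-1 : ℝ) 1 := fun u =>
    ⟨by linarith [circleCoord_nonneg u], (circleCoord_lt_one u).le⟩
  rw [circleCoord_branch h0 h1, circleCoord_branch h0 h1, add_sub_add_left_eq_sub, ← mul_sub,
    abs_mul, abs_of_pos hb]
  set D := |circleCoord u₁ - circleCoord u₀|
  have hy : y₀ ≤ y₁ := by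
    have : 0 ≤ L * D := by positivity
    linarith
  have hx : |f u₁ y₀ - f u₀ y₀| ≤ K * D := by
    simpa using (hK _ (hsub u₀) _ (hsub u₁) y₀ hy₀ y₀ hy₀).1
  have hyd : c * branchScale a b * (y₁ - y₀) ≤ f u₁ y₁ - f u₁ y₀ := by
    refine (convex_Icc s' t').mul_sub_le_image_sub_of_le_deriv
      (hf.contDiff_fibre u₁).continuous.continuousOn
      (hf.differentiable_fibre u₁).differentiableOn
      (fun y hy => hd b u₁ y (interior_subset hy)) y₀ hy₀ y₁ hy₁ hy
  have hKL : K ≤ (c - 1) * branchScale a b * L := by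
    have : K = (c - 1) * min a (1 - a) * L := by
      rw [mul_comm, hL, div_mul_cancel₀ _ hden.ne']
    rw [this]
    have := min_le_branchScale (a := a) b
    have : 0 < c - 1 := by linarith
    gcongr
  have hD : 0 ≤ D := abs_nonneg _
  have h2 : c * branchScale a b * (L * D) < c * branchScale a b * (y₁ - y₀) :=
    mul_lt_mul_of_pos_left h (by positivity)
  have h3 := mul_le_mul_of_nonneg_right hKL hD
  have h4 := (abs_le.1 hx).1
  nlinarith

end IsBakerDrivenSystem

/-! ### Gibbs measures -/

/-- The set of points with a given forward word. -/
def wordCylinder (a : ℝ) (w : List Bool) : Set (UnitAddCircle × UnitAddCircle) :=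
  {θ | word a w.length θ.1 = w}

theorem measurableSet_wordCylinder {a : ℝ} (h0 : 0 < a) (h1 : a < 1) (w : List Bool) :
    MeasurableSet (wordCylinder a w) :=
  measurable_fst (measurableSet_word h0 h1 w.length w)

theorem forwardCylinder_eq {a : ℝ} {w : List Bool} {θ : UnitAddCircle × UnitAddCircle}
    (hθ : θ ∈ wordCylinder a w) : forwardCylinder a w.length θ = wordCylinder a w := by
  ext θ'
  have : word a w.length θ.1 = w := hθ
  simp only [forwardCylinder, wordCylinder, mem_ofPred_eq, sameItinerary_iff, this]
  exact eq_comm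

namespace IsGibbsMeasure

open MeasureTheory

variable {a : ℝ} {ν : Measure (UnitAddCircle × UnitAddCircle)} (hν : IsGibbsMeasure a ν)
  (h0 : 0 < a) (h1 : a < 1)

include hν h0 h1

/-- Birkhoff sums add up along one orbit with word `v ++ w`. Two upper Gibbs bounds and one lower
bound cost a factor `C` each, hence `C⁻¹ ^ 3`. -/
theorem exists_quasi_bernoulli : ∃ κ : ℝ, 0 < κ ∧
    (∀ w, 0 < ν.real (wordCylinder a w)) ∧
    ∀ v w, κ * ν.real (wordCylinder a v) * ν.real (wordCylinder a w) ≤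
      ν.real (wordCylinder a (v ++ w)) := by
  obtain ⟨ψ, -, p, C, hC, h⟩ := hν.gibbs
  have key : ∀ w, ∀ θ ∈ wordCylinder a w,
      C⁻¹ * Real.exp (birkhoffSum (bakerMap a) ψ w.length θ - w.length * p) ≤
        ν.real (wordCylinder a w) ∧ ν.real (wordCylinder a w) ≤
        C * Real.exp (birkhoffSum (bakerMap a) ψ w.length θ - w.length * p) := by
    intro w θ hθ
    have := h w.length θ
    rwa [forwardCylinder_eq hθ] at this
  have hne : ∀ w, ∃ θ, θ ∈ wordCylinder a w := fun w => by
    obtain ⟨ξ, hξ⟩ := exists_word_eq h0 h1 w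
    exact ⟨(ξ, 0), hξ⟩
  refine ⟨C⁻¹ ^ 3, by positivity, fun w => ?_, fun v w => ?_⟩
  · obtain ⟨θ, hθ⟩ := hne w
    exact lt_of_lt_of_le (by positivity) (key w θ hθ).1
  · obtain ⟨θ, hθ⟩ := hne (v ++ w)
    have hθ' : word a (v.length + w.length) θ.1 = v ++ w := by
      rw [← List.length_append]; exact hθ
    rw [word_add] at hθ'
    obtain ⟨hv, hw⟩ := List.append_inj hθ' (length_word _ _)
    have h1 := (key v θ hv).2
    have h2 := (key w ((bakerMap a)^[v.length] θ)
      (by rw [bakerMap_iterate]; exact hw)).2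
    have h3 := (key (v ++ w) θ hθ).1
    rw [List.length_append, birkhoffSum_add] at h3
    refine le_trans ?_ h3
    set X := birkhoffSum (bakerMap a) ψ v.length θ
    set Y := birkhoffSum (bakerMap a) ψ w.length ((bakerMap a)^[v.length] θ)
    have e : Real.exp (X + Y - ((v.length + w.length : ℕ) : ℝ) * p) =
        Real.exp (X - v.length * p) * Real.exp (Y - w.length * p) := by
      rw [← Real.exp_add]; push_cast; ring_nf
    rw [e]
    calc C⁻¹ ^ 3 * ν.real (wordCylinder a v) * ν.real (wordCylinder a w)
        ≤ C⁻¹ ^ 3 * (C * Real.exp (X - v.length * p)) * (C * Real.exp (Y - w.length * p)) := by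
          gcongr
      _ = C⁻¹ * (Real.exp (X - v.length * p) * Real.exp (Y - w.length * p)) := by
          field_simp

/-- Sets of stable coordinates that meet the tree of cylinders, refined by one of two fixed words,
at a whole level have measure bounded below. -/
theorem exists_le_measureReal {ζ₀ ζ₁ : List Bool} (hζ : ζ₀.length = ζ₁.length) :
    ∃ κ : ℝ, 0 < κ ∧ ∀ E : Set UnitAddCircle, MeasurableSet E → ∀ n : ℕ,
      (∀ v : List Bool, v.length = n → (∀ x, branches a v (branches a ζ₀ x) ∈ E) ∨
        ∀ x, branches a v (branches a ζ₁ x) ∈ E) → κ ≤ ν.real (Prod.snd ⁻¹' E) := by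
  have := hν.isProbabilityMeasure
  obtain ⟨κ, hκ, hpos, hqb⟩ := hν.exists_quasi_bernoulli h0 h1
  set β := min (ν.real (wordCylinder a ζ₀)) (ν.real (wordCylinder a ζ₁)) with hβ
  have hβ0 : 0 < β := lt_min (hpos _) (hpos _)
  refine ⟨κ * β, by positivity, fun E hE n h => ?_⟩
  have hz : ∀ v : List.Vector Bool n, ∃ z : List Bool, z.length = ζ₀.length ∧
      β ≤ ν.real (wordCylinder a z) ∧ ∀ x, branches a v.1 (branches a z x) ∈ E := by
    intro v
    rcases h v.1 v.2 with h | h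
    · exact ⟨ζ₀, rfl, min_le_left _ _, h⟩
    · exact ⟨ζ₁, hζ.symm, min_le_right _ _, h⟩
  choose z hzl hzβ hzE using hz
  have hdisj : ∀ w w' : List Bool, w.length = w'.length → w ≠ w' →
      Disjoint (wordCylinder a w) (wordCylinder a w') := by
    intro w w' hl hne
    rw [Set.disjoint_left]
    intro θ hw hw'
    have e1 : word a w.length θ.1 = w := hw
    have e2 : word a w'.length θ.1 = w' := hw'
    exact hne (by rw [← e1, hl, e2])
  -- By invariance `E` may be tested at time `ζ₀.length + n`, when a point with word `z v ++ v` has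
  -- its stable coordinate in the image of `branches a v ∘ branches a (z v)`, hence in `E`.
  have hT := hν.invariant.iterate (ζ₀.length + n)
  have hEm : MeasurableSet (Prod.snd ⁻¹' E : Set (UnitAddCircle × UnitAddCircle)) :=
    measurable_snd hE
  rw [← hT.measureReal_preimage hEm.nullMeasurableSet]
  have hsub : (⋃ v ∈ (Finset.univ : Finset (List.Vector Bool n)), wordCylinder a (z v ++ v.1)) ⊆
      (bakerMap a)^[ζ₀.length + n] ⁻¹' (Prod.snd ⁻¹' E) := by
    intro θ hθ
    simp only [mem_iUnion, Finset.mem_univ, exists_true_left] at hθ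
    obtain ⟨v, hv⟩ := hθ
    have hw : word a (ζ₀.length + n) θ.1 = z v ++ v.1 := by
      have : word a (z v ++ v.1).length θ.1 = z v ++ v.1 := hv
      rwa [List.length_append, hzl, v.2] at this
    simp only [mem_preimage, bakerMap_iterate, hw, branches_append]
    exact hzE v _
  refine le_trans ?_ (measureReal_mono hsub)
  rw [measureReal_biUnion_finset]
  · have hone : 1 ≤ ∑ v : List.Vector Bool n, ν.real (wordCylinder a v.1) := by
      refine le_trans ?_ (measureReal_biUnion_finset_le Finset.univ _)
      refine (probReal_univ (μ := ν)).symm.le.trans (measureReal_mono (fun θ _ => ?_)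
        (measure_ne_top _ _))
      simp only [mem_iUnion, Finset.mem_univ, exists_true_left]
      exact ⟨⟨word a n θ.1, length_word n θ.1⟩, by simp [wordCylinder, length_word]⟩
    calc κ * β = κ * β * 1 := (mul_one _).symm
      _ ≤ κ * β * ∑ v : List.Vector Bool n, ν.real (wordCylinder a v.1) := by gcongr
      _ = ∑ v : List.Vector Bool n, κ * β * ν.real (wordCylinder a v.1) := Finset.mul_sum _ _ _
      _ ≤ _ := Finset.sum_le_sum fun v _ => le_trans (by gcongr; exact hzβ v) (hqb (z v) v.1)
  · intro v _ v' _ hne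
    refine hdisj _ _ (by simp [hzl]) fun he => hne ?_
    exact Subtype.ext (List.append_inj he (by rw [hzl, hzl])).2
  · exact fun v _ => measurableSet_wordCylinder h0 h1 _

end IsGibbsMeasure

/-- An antitone sequence of measurable sets with null intersection has arbitrarily small
measures. -/
theorem MeasureTheory.exists_measureReal_lt {α : Type*} [MeasurableSpace α]
    (μ : MeasureTheory.Measure α) [MeasureTheory.IsFiniteMeasure μ] {A : ℕ → Set α}
    (hA : Antitone A) (hm : ∀ n, MeasurableSet (A n)) (h : μ (⋂ n, A n) = 0) {ε : ℝ}
    (hε : 0 < ε) : ∃ n, μ.real (A n) < ε := by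
  have := MeasureTheory.tendsto_measure_iInter_atTop (μ := μ)
    (fun n => (hm n).nullMeasurableSet) hA ⟨0, MeasureTheory.measure_ne_top _ _⟩
  rw [h] at this
  have h2 := (ENNReal.tendsto_toReal ENNReal.zero_ne_top).comp this
  exact (h2.eventually (gt_mem_nhds (by simpa using hε))).exists

/-- If a Gibbs measure does not charge the pinched points, then the bounding graphs over two
cylinders cannot be uniformly ordered in all future cylinders. -/
theorem IsBakerDrivenSystem.not_forall_upper_lt_lower {a : ℝ} {f : UnitAddCircle → ℝ → ℝ}
    {s t s' t' : ℝ} (hf : IsBakerDrivenSystem a f s t s' t') {M : ℝ} (hM : ∀ x y, |f x y| ≤ M)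
    {ν : MeasureTheory.Measure (UnitAddCircle × UnitAddCircle)} (hν : IsGibbsMeasure a ν)
    (hP : ν (pinchedSet a f) = 0) {ζ₀ ζ₁ : List Bool} (hζ : ζ₀.length = ζ₁.length) :
    ¬ ∀ (v : List Bool) (x₀ x₁ : UnitAddCircle), upper a f M (branches a v (branches a ζ₀ x₀)) <
      lower a f M (branches a v (branches a ζ₁ x₁)) := by
  intro hlt
  have h0 := hf.a_pos
  have h1 := hf.a_lt_one
  have := hν.isProbabilityMeasure
  obtain ⟨κ, hκ, hκE⟩ := hν.exists_le_measureReal h0 h1 hζ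
  have hum := (hf.measurable_upper hM)
  have hlm := (hf.measurable_lower hM)
  -- Nearly pinched points: these sets decrease to `Q`, whose preimage is null.
  let A : ℕ → Set UnitAddCircle := fun j =>
    {x | upper a f M x - lower a f M x ≤ 1 / ((j : ℝ) + 1)}
  have hAm : ∀ j, MeasurableSet (A j) := fun j =>
    measurableSet_le (hum.sub hlm) measurable_const
  obtain ⟨j, hj⟩ : ∃ j, ν.real (Prod.snd ⁻¹' A j) < κ / 2 := by
    refine MeasureTheory.exists_measureReal_lt ν (A := fun j => Prod.snd ⁻¹' A j) ?_
      (fun j => measurable_snd (hAm j)) ?_ (by positivity)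
    · intro i j hij θ hθ
      simp only [mem_preimage, A, mem_ofPred_eq] at hθ ⊢
      exact hθ.trans (Nat.one_div_le_one_div hij)
    · refine MeasureTheory.measure_mono_null (fun θ hθ => ?_) hP
      rw [hf.pinchedSet_eq hM]
      simp only [mem_iInter, mem_preimage, A, mem_ofPred_eq] at hθ
      have : upper a f M θ.2 - lower a f M θ.2 ≤ 0 :=
        ge_of_tendsto' tendsto_one_div_add_atTop_nhds_zero_nat hθ
      exact le_antisymm (by linarith) (hf.lower_le_upper hM θ.2)
  set δ : ℝ := 1 / ((j : ℝ) + 1) with hδ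
  have hδ0 : 0 < δ := by positivity
  -- Points where `pull k` from `-M` is still far from `lower`: these sets decrease to the empty
  -- set.
  let B : ℕ → Set UnitAddCircle := fun k => {x | δ / 4 ≤ lower a f M x - pull a f k x (-M)}
  have hBm : ∀ k, MeasurableSet (B k) := fun k =>
    measurableSet_le measurable_const (hlm.sub (hf.continuous_pull_left k (-M)).measurable)
  obtain ⟨k, hk⟩ : ∃ k, ν.real (Prod.snd ⁻¹' B k) < κ / 2 := by
    refine MeasureTheory.exists_measureReal_lt ν (A := fun j => Prod.snd ⁻¹' B j) ?_
      (fun j => measurable_snd (hBm j)) ?_ (by positivity)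
    · intro i j hij θ hθ
      have := hf.monotone_pull hM θ.2 hij
      simp only [mem_preimage, B, mem_ofPred_eq] at hθ ⊢
      linarith
    · rw [show (⋂ n, Prod.snd ⁻¹' B n : Set (UnitAddCircle × UnitAddCircle)) = ∅ from ?_,
        MeasureTheory.measure_empty]
      refine eq_empty_of_forall_notMem fun θ hθ => ?_
      simp only [mem_iInter, mem_preimage, B, mem_ofPred_eq] at hθ
      have h3 : δ / 4 ≤ lower a f M θ.2 - lower a f M θ.2 :=
        ge_of_tendsto' (tendsto_const_nhds.sub (hf.tendsto_lower hM θ.2)) hθ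
      linarith
  obtain ⟨η, hη, hunif⟩ := Metric.uniformContinuous_iff.1
    (CompactSpace.uniformContinuous_of_continuous (hf.continuous_pull_left k (-M)))
    (δ / 4) (by positivity)
  obtain ⟨n, hn⟩ := exists_max_pow_lt h0 h1 hη
  -- If `p ∉ A j` and `q ∉ B k`, then `lower q > upper p > lower p + δ ≥ pull k p + δ > pull k q +
  -- 3δ/4 > lower q + δ/2`, with `pull k` taken at `-M`: a contradiction.
  have hE := hκE (A j ∪ B k) ((hAm j).union (hBm k)) n fun v hv => by
    by_contra! hcon
    obtain ⟨⟨x₀, hx₀⟩, x₁, hx₁⟩ := hcon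
    have hd := hlt v x₀ x₁
    set p := branches a v (branches a ζ₀ x₀)
    set q := branches a v (branches a ζ₁ x₁)
    have hpq : dist p q < η := by
      refine (dist_le_abs_circleCoord_sub _ _).trans_lt
        ((abs_circleCoord_branches_sub_le h0 h1 v _ _).trans_lt ?_)
      rw [hv]; exact hn n le_rfl
    have hosc := hunif hpq
    rw [Real.dist_eq, abs_lt] at hosc
    simp only [mem_union, A, B, mem_ofPred_eq, not_or, not_le] at hx₀ hx₁
    have := hf.pull_le_lower hM k p
    linarith [hx₀.1, hx₁.2, hosc.1]
  rw [preimage_union] at hE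
  have := MeasureTheory.measureReal_union_le (μ := ν)
    (Prod.snd ⁻¹' A j : Set (UnitAddCircle × UnitAddCircle)) (Prod.snd ⁻¹' B k)
  linarith

/-! ### Lipschitz dependence over the pinched points -/

namespace IsBakerDrivenSystem

variable {a : ℝ} {f : UnitAddCircle → ℝ → ℝ} {s t s' t' : ℝ}
  (hf : IsBakerDrivenSystem a f s t s' t')

include hf

/-- Over the pinched points the attractor is a Lipschitz function of the stable coordinate. -/
theorem exists_lipschitz_upper {M : ℝ} (hM : ∀ x y, |f x y| ≤ M)
    {ν : MeasureTheory.Measure (UnitAddCircle × UnitAddCircle)} (hν : IsGibbsMeasure a ν)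
    (hP : ν (pinchedSet a f) = 0) :
    ∃ L : ℝ, 0 ≤ L ∧ ∀ x₀ x₁, upper a f M x₀ = lower a f M x₀ → upper a f M x₁ = lower a f M x₁ →
      upper a f M x₁ - upper a f M x₀ ≤ L * |circleCoord x₁ - circleCoord x₀| := by
  have h0 := hf.a_pos
  have h1 := hf.a_lt_one
  obtain ⟨L, hL0, hL⟩ := hf.exists_cone_invariant
  refine ⟨L, hL0, fun x₀ x₁ hx₀ hx₁ => ?_⟩
  by_contra! hgap
  -- The steepness condition is what survives the induction; the mere ordering of the graphs would
  -- not.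
  have horder : ∀ (v : List Bool) (u₀ u₁ : UnitAddCircle), upper a f M u₀ ∈ Icc s' t' →
      lower a f M u₁ ∈ Icc s' t' →
      L * |circleCoord u₁ - circleCoord u₀| < lower a f M u₁ - upper a f M u₀ →
      upper a f M (branches a v u₀) < lower a f M (branches a v u₁) := by
    intro v
    induction v with
    | nil =>
      intro u₀ u₁ _ _ h
      have : 0 ≤ L * |circleCoord u₁ - circleCoord u₀| := by positivity
      simp only [branches]
      linarith
    | cons b v ih =>
      intro u₀ u₁ hu₀ hu₁ h
      refine ih _ _ ?_ ?_ ?_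
      · rw [hf.upper_branch hM]
        exact hf.I_subset_J (interior_subset (hf.mapsTo _ _ hu₀))
      · rw [hf.lower_branch hM]
        exact hf.I_subset_J (interior_subset (hf.mapsTo _ _ hu₁))
      · rw [hf.upper_branch hM, hf.lower_branch hM]
        exact hL b u₀ u₁ _ hu₀ _ hu₁ h
  set D := |circleCoord x₁ - circleCoord x₀|
  set g := upper a f M x₁ - upper a f M x₀ - L * D with hg
  have hg0 : 0 < g := by linarith
  obtain ⟨hs, ht⟩ := hf.lt_lt
  have hm₀ := hf.upper_mem_of_eq hM hx₀
  have hm₁ := hf.upper_mem_of_eq hM hx₁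
  obtain ⟨ε₀, hε₀, hn₀⟩ := Metric.eventually_nhds_iff.1
    ((hf.eventually_upper_lt hM (x := x₀) (r := min t' (upper a f M x₀ + g / 4))
      (lt_min (by linarith [hm₀.2]) (by linarith))).and
      (hf.eventually_lt_lower hM (x := x₀) (r := s') (by linarith [hm₀.1])))
  obtain ⟨ε₁, hε₁, hn₁⟩ := Metric.eventually_nhds_iff.1
    ((hf.eventually_lt_lower hM (x := x₁) (r := max s' (upper a f M x₁ - g / 4))
      (max_lt (by linarith [hm₁.1]) (by linarith))).and
      (hf.eventually_upper_lt hM (x := x₁) (r := t') (by linarith [hm₁.2])))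
  -- Moving both base points by less than `g / (8 * (L + 1))` changes the term with `L` by at most
  -- `g / 4`; the two graph values lose less than `g / 4` each, so part of the gap `g` remains.
  have hη : 0 < min (min ε₀ ε₁) (g / (8 * (L + 1))) := by positivity
  obtain ⟨N, hN⟩ := exists_max_pow_lt h0 h1 hη
  have hN := hN N le_rfl
  obtain ⟨ζ₀, hζ₀, z₀, hz₀⟩ := exists_branches_eq h0 h1 N x₀
  obtain ⟨ζ₁, hζ₁, z₁, hz₁⟩ := exists_branches_eq h0 h1 N x₁
  refine hf.not_forall_upper_lt_lower hM hν hP (hζ₀.trans hζ₁.symm) fun v w₀ w₁ => ?_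
  have hc₀ := abs_circleCoord_branches_sub_le h0 h1 ζ₀ w₀ z₀
  have hc₁ := abs_circleCoord_branches_sub_le h0 h1 ζ₁ w₁ z₁
  rw [hz₀, hζ₀] at hc₀
  rw [hz₁, hζ₁] at hc₁
  set u₀ := branches a ζ₀ w₀
  set u₁ := branches a ζ₁ w₁
  have hlt₀ := hc₀.trans_lt hN
  have hlt₁ := hc₁.trans_lt hN
  simp only [lt_min_iff] at hlt₀ hlt₁
  obtain ⟨hup₀, hlo₀⟩ := hn₀ ((dist_le_abs_circleCoord_sub _ _).trans_lt hlt₀.1.1)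
  obtain ⟨hlo₁, hup₁⟩ := hn₁ ((dist_le_abs_circleCoord_sub _ _).trans_lt hlt₁.1.2)
  have hle₀ := hf.lower_le_upper hM u₀
  have hle₁ := hf.lower_le_upper hM u₁
  rw [lt_min_iff] at hup₀
  rw [max_lt_iff] at hlo₁
  refine horder v u₀ u₁ ⟨by linarith, hup₀.1.le⟩ ⟨hlo₁.1.le, by linarith⟩ ?_
  have hd : |circleCoord u₁ - circleCoord u₀| ≤ D + 2 * (g / (8 * (L + 1))) := by
    have e : circleCoord u₁ - circleCoord u₀ = (circleCoord u₁ - circleCoord x₁) +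
        (circleCoord x₁ - circleCoord x₀) - (circleCoord u₀ - circleCoord x₀) := by ring
    rw [e]
    refine (abs_sub _ _).trans ?_
    have := abs_add_le (circleCoord u₁ - circleCoord x₁) (circleCoord x₁ - circleCoord x₀)
    linarith [hlt₀.2, hlt₁.2]
  have h5 : L * (2 * (g / (8 * (L + 1)))) ≤ g / 4 := by
    have : L * (2 * (g / (8 * (L + 1)))) = g / 4 * (L / (L + 1)) := by field_simp; ring
    rw [this]
    exact mul_le_of_le_one_right (by positivity) ((div_le_one (by positivity)).2 (by linarith))
  calc L * |circleCoord u₁ - circleCoord u₀| ≤ L * (D + 2 * (g / (8 * (L + 1)))) := by gcongr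
    _ = L * D + L * (2 * (g / (8 * (L + 1)))) := by ring
    _ < lower a f M u₁ - upper a f M u₀ := by linarith [hup₀.2, hlo₁.2]

end IsBakerDrivenSystem

/-! ### Smoothness of invariant Lipschitz curves -/

/-- Difference quotients whose dependence on the increment is contracted by a scaling converge
linearly. -/
theorem exists_derivative_of_quotient_contraction {g : ℝ → ℝ} {K : ℝ}
    (h : ∀ r ∈ Icc (0 : ℝ) 1, ∀ r₁ ∈ Icc (0 : ℝ) 1, ∀ r₂ ∈ Icc (0 : ℝ) 1, r₁ ≠ r → r₂ ≠ r →
      |(g r₁ - g r) / (r₁ - r) - (g r₂ - g r) / (r₂ - r)| ≤ K * (|r₁ - r| + |r₂ - r|)) :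
    ∃ ψ : ℝ → ℝ, ∀ r ∈ Icc (0 : ℝ) 1, ∀ r' ∈ Icc (0 : ℝ) 1,
      |g r' - g r - ψ r * (r' - r)| ≤ K * (r' - r) ^ 2 := by
  suffices H : ∀ r ∈ Icc (0 : ℝ) 1, ∃ d : ℝ, ∀ r' ∈ Icc (0 : ℝ) 1, r' ≠ r →
      |(g r' - g r) / (r' - r) - d| ≤ K * |r' - r| by
    choose! ψ hψ using H
    refine ⟨ψ, fun r hr r' hr' => ?_⟩
    rcases eq_or_ne r' r with rfl | hne
    · simp
    have hne' : r' - r ≠ 0 := sub_ne_zero.2 hne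
    have e : g r' - g r - ψ r * (r' - r) = ((g r' - g r) / (r' - r) - ψ r) * (r' - r) := by
      field_simp
    rw [e, abs_mul, ← sq_abs, pow_two, ← mul_assoc]
    exact mul_le_mul_of_nonneg_right (hψ r hr r' hr' hne) (abs_nonneg _)
  intro r hr
  obtain ⟨e, he, her⟩ : ∃ e ∈ Icc (0 : ℝ) 1, e ≠ r := by
    rcases eq_or_ne r 0 with rfl | h0
    · exact ⟨1, by simp, one_ne_zero⟩
    · exact ⟨0, by simp, h0.symm⟩
  -- Points of `[0, 1]` tending to `r` without reaching it; the quotients along them are Cauchy and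
  -- their limit is the derivative.
  let ρ : ℕ → ℝ := fun n => r + (1 / 2) ^ n * (e - r)
  have hpow : ∀ n : ℕ, (0 : ℝ) < (1 / 2) ^ n ∧ ((1 : ℝ) / 2) ^ n ≤ 1 := fun n =>
    ⟨by positivity, pow_le_one₀ (by norm_num) (by norm_num)⟩
  have hρ : ∀ n, ρ n ∈ Icc (0 : ℝ) 1 := fun n => by
    obtain ⟨hp, hp1⟩ := hpow n
    have := (convex_Icc (0 : ℝ) 1).add_smul_sub_mem hr he ⟨hp.le, hp1⟩
    simpa [ρ] using this
  have hρne : ∀ n, ρ n ≠ r := fun n => by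
    simpa [ρ] using sub_ne_zero.2 her
  have hρlim : Filter.Tendsto (fun n => |ρ n - r|) Filter.atTop (nhds 0) := by
    have h1 := (tendsto_pow_atTop_nhds_zero_of_lt_one (r := (1 : ℝ) / 2) (by norm_num)
      (by norm_num)).mul_const (e - r)
    have h2 := h1.abs
    simpa [ρ] using h2
  have hq : CauchySeq fun n => (g (ρ n) - g r) / (ρ n - r) := by
    rw [Metric.cauchySeq_iff']
    intro ε hε
    have hl : Filter.Tendsto (fun n => K * (|ρ n - r| + |ρ n - r|)) Filter.atTop (nhds 0) := by
      simpa using (hρlim.add hρlim).const_mul K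
    have hK : 0 ≤ K := by
      have h3 := (abs_nonneg _).trans (h r hr e he e he her her)
      have h4 : 0 < |e - r| := abs_pos.2 (sub_ne_zero.2 her)
      by_contra! hneg
      nlinarith
    obtain ⟨N, hN⟩ := (hl.eventually (gt_mem_nhds hε)).exists
    refine ⟨N, fun n hn => ?_⟩
    rw [Real.dist_eq]
    refine (h r hr _ (hρ n) _ (hρ N) (hρne n) (hρne N)).trans_lt (lt_of_le_of_lt ?_ hN)
    have : |ρ n - r| ≤ |ρ N - r| := by
      simp only [ρ, add_sub_cancel_left, abs_mul]
      rw [abs_of_pos (hpow n).1, abs_of_pos (hpow N).1]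
      exact mul_le_mul_of_nonneg_right
        (pow_le_pow_of_le_one (by norm_num) (by norm_num) hn) (abs_nonneg _)
    gcongr
  obtain ⟨d, hd⟩ := cauchySeq_tendsto_of_complete hq
  refine ⟨d, fun r' hr' hne => ?_⟩
  refine le_of_tendsto_of_tendsto (tendsto_const_nhds.sub hd).abs
    ((tendsto_const_nhds.add hρlim).const_mul K) (Filter.Eventually.of_forall fun n =>
      h r hr r' hr' (ρ n) (hρ n) hne (hρne n)) |>.trans (by simp)

/-- A Lipschitz solution of `g (a r) = F (r, g r)`, where the derivative of `F` in its second
variable is larger than `a`, is differentiable with quadratic remainder. -/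
theorem exists_derivative_of_functional_equation {g A B : ℝ → ℝ} {a c K L : ℝ} (ha : 0 < a)
    (ha1 : a < 1) (hc : 1 < c)
    (hg : ∀ r ∈ Icc (0 : ℝ) 1, ∀ r' ∈ Icc (0 : ℝ) 1, |g r' - g r| ≤ L * |r' - r|)
    (hB : ∀ r ∈ Icc (0 : ℝ) 1, c * a ≤ B r)
    (hT : ∀ r ∈ Icc (0 : ℝ) 1, ∀ r' ∈ Icc (0 : ℝ) 1,
      |g (a * r') - g (a * r) - (A r * (r' - r) + B r * (g r' - g r))| ≤ K * (r' - r) ^ 2) :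
    ∃ K' : ℝ, ∃ ψ : ℝ → ℝ, ∀ r ∈ Icc (0 : ℝ) 1, ∀ r' ∈ Icc (0 : ℝ) 1,
      |g r' - g r - ψ r * (r' - r)| ≤ K' * (r' - r) ^ 2 := by
  let q : ℝ → ℝ → ℝ := fun r r' => (g r' - g r) / (r' - r)
  have hc0 : 0 < c := by linarith
  have hK : 0 ≤ K := by
    have := (abs_nonneg _).trans (hT 0 (by simp) 1 (by simp))
    simpa using this
  have hL : 0 ≤ L := by
    have := (abs_nonneg _).trans (hg 0 (by simp) 1 (by simp))
    simpa using this
  have hmem : ∀ r ∈ Icc (0 : ℝ) 1, a * r ∈ Icc (0 : ℝ) 1 := fun r hr =>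
    ⟨mul_nonneg ha.le hr.1, by nlinarith [hr.1, hr.2]⟩
  have hqT : ∀ r ∈ Icc (0 : ℝ) 1, ∀ r' ∈ Icc (0 : ℝ) 1, r' ≠ r →
      |a * q (a * r) (a * r') - (A r + B r * q r r')| ≤ K * |r' - r| := by
    intro r hr r' hr' hne
    have hne' : r' - r ≠ 0 := sub_ne_zero.2 hne
    have e : a * q (a * r) (a * r') - (A r + B r * q r r') =
        (g (a * r') - g (a * r) - (A r * (r' - r) + B r * (g r' - g r))) / (r' - r) := by
      simp only [q]
      rw [← mul_sub]
      field_simp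
    rw [e, abs_div, div_le_iff₀ (abs_pos.2 hne'), mul_assoc, ← pow_two, sq_abs]
    exact hT r hr r' hr'
  -- Subtracting two quotients with the same base point cancels `A r`; dividing by `B r ≥ c * a`
  -- leaves the factor `1 / c`.
  have hstep : ∀ r ∈ Icc (0 : ℝ) 1, ∀ r₁ ∈ Icc (0 : ℝ) 1, ∀ r₂ ∈ Icc (0 : ℝ) 1, r₁ ≠ r → r₂ ≠ r →
      c * |q r r₁ - q r r₂| ≤ |q (a * r) (a * r₁) - q (a * r) (a * r₂)| +
        K / a * (|r₁ - r| + |r₂ - r|) := by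
    intro r hr r₁ hr₁ r₂ hr₂ hne₁ hne₂
    have e1 := hqT r hr r₁ hr₁ hne₁
    have e2 := hqT r hr r₂ hr₂ hne₂
    set X₁ := q (a * r) (a * r₁)
    set X₂ := q (a * r) (a * r₂)
    have h3 : B r * |q r r₁ - q r r₂| ≤ a * |X₁ - X₂| + K * |r₁ - r| + K * |r₂ - r| := by
      have hBr : 0 < B r := (mul_pos hc0 ha).trans_le (hB r hr)
      have e0 : B r * |q r r₁ - q r r₂| = |B r * (q r r₁ - q r r₂)| := by
        rw [abs_mul, abs_of_pos hBr]
      have e : B r * (q r r₁ - q r r₂) = a * (X₁ - X₂) - (a * X₁ - (A r + B r * q r r₁)) +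
          (a * X₂ - (A r + B r * q r r₂)) := by ring
      rw [e0, e]
      refine (abs_add_le _ _).trans (add_le_add ((abs_sub _ _).trans (add_le_add ?_ e1)) e2)
      rw [abs_mul, abs_of_pos ha]
    have h4 : c * a * |q r r₁ - q r r₂| ≤ a * |X₁ - X₂| + K * |r₁ - r| + K * |r₂ - r| :=
      (mul_le_mul_of_nonneg_right (hB r hr) (abs_nonneg _)).trans h3
    have e : c * |q r r₁ - q r r₂| = (c * a * |q r r₁ - q r r₂|) / a := by field_simp
    rw [e, div_le_iff₀ ha]
    refine h4.trans (le_of_eq ?_)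
    field_simp
    ring
  have hqL : ∀ r ∈ Icc (0 : ℝ) 1, ∀ r' ∈ Icc (0 : ℝ) 1, |q r r'| ≤ L := by
    intro r hr r' hr'
    simp only [q, abs_div]
    exact div_le_of_le_mul₀ (abs_nonneg _) hL (hg r hr r' hr')
  -- The solution of `K' + K / a = c * K'`, so that the error bound reproduces itself under the
  -- induction.
  set K' := K / a / (c - 1) with hK'
  have hc1 : 0 < c - 1 := by linarith
  have hK'0 : 0 ≤ K' := by positivity
  have hKK : K' + K / a = c * K' := by
    have : K / a = (c - 1) * K' := by rw [hK', mul_div_cancel₀ _ hc1.ne']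
    rw [this]; ring
  have hiter : ∀ n : ℕ, ∀ r ∈ Icc (0 : ℝ) 1, ∀ r₁ ∈ Icc (0 : ℝ) 1, ∀ r₂ ∈ Icc (0 : ℝ) 1,
      r₁ ≠ r → r₂ ≠ r →
      |q r r₁ - q r r₂| ≤ c⁻¹ ^ n * (2 * L) + K' * (|r₁ - r| + |r₂ - r|) := by
    intro n
    induction n with
    | zero =>
      intro r hr r₁ hr₁ r₂ hr₂ _ _
      have := abs_sub (q r r₁) (q r r₂)
      have := hqL r hr r₁ hr₁
      have := hqL r hr r₂ hr₂
      have : 0 ≤ K' * (|r₁ - r| + |r₂ - r|) := by positivity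
      simp only [pow_zero, one_mul]
      linarith
    | succ n ih =>
      intro r hr r₁ hr₁ r₂ hr₂ hne₁ hne₂
      have h1 := hstep r hr r₁ hr₁ r₂ hr₂ hne₁ hne₂
      have h2 := ih (a * r) (hmem r hr) (a * r₁) (hmem r₁ hr₁) (a * r₂) (hmem r₂ hr₂)
        (fun h => hne₁ (mul_left_cancel₀ ha.ne' h)) (fun h => hne₂ (mul_left_cancel₀ ha.ne' h))
      rw [← mul_sub, ← mul_sub, abs_mul, abs_mul, abs_of_pos ha, ← mul_add] at h2
      set X := |r₁ - r| + |r₂ - r|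
      have hX : 0 ≤ X := by positivity
      have h3 : K' * (a * X) ≤ K' * X := by
        gcongr
        exact mul_le_of_le_one_left hX ha1.le
      have h4 : c * |q r r₁ - q r r₂| ≤ c⁻¹ ^ n * (2 * L) + (K' + K / a) * X := by linarith
      rw [hKK] at h4
      have h5 : c * (c⁻¹ ^ (n + 1) * (2 * L) + K' * X) = c⁻¹ ^ n * (2 * L) + c * K' * X := by
        rw [pow_succ]; field_simp
      exact le_of_mul_le_mul_left (h4.trans h5.symm.le) hc0
  refine ⟨K', exists_derivative_of_quotient_contraction fun r hr r₁ hr₁ r₂ hr₂ hne₁ hne₂ => ?_⟩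
  have hlim : Filter.Tendsto (fun n : ℕ => c⁻¹ ^ n * (2 * L) + K' * (|r₁ - r| + |r₂ - r|))
      Filter.atTop (nhds (0 * (2 * L) + K' * (|r₁ - r| + |r₂ - r|))) :=
    ((tendsto_pow_atTop_nhds_zero_of_lt_one (by positivity)
      (inv_lt_one_of_one_lt₀ hc)).mul_const _).add_const _
  rw [zero_mul, zero_add] at hlim
  exact ge_of_tendsto' hlim fun n => hiter n r hr r₁ hr₁ r₂ hr₂ hne₁ hne₂

/-- The periodic extension of a function on `[0, 1]` with quadratic Taylor remainders whose values
and derivatives match at the end points is differentiable with Lipschitz derivative. -/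
theorem hasDerivAt_comp_fract {g ψ : ℝ → ℝ} {K : ℝ} (hg : g 0 = g 1) (hψ : ψ 0 = ψ 1)
    (h : ∀ r ∈ Icc (0 : ℝ) 1, ∀ r' ∈ Icc (0 : ℝ) 1,
      |g r' - g r - ψ r * (r' - r)| ≤ K * (r' - r) ^ 2) :
    (∀ r, HasDerivAt (fun r => g (Int.fract r)) (ψ (Int.fract r)) r) ∧
      ∀ r r', |ψ (Int.fract r') - ψ (Int.fract r)| ≤ 2 * K * |r' - r| := by
  have hK : 0 ≤ K := by
    have := (abs_nonneg _).trans (h 0 (by simp) 1 (by simp))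
    simpa using this
  have hper : ∀ φ : ℝ → ℝ, φ 0 = φ 1 → ∀ (m : ℤ), ∀ r ∈ Icc (m : ℝ) (m + 1),
      φ (Int.fract r) = φ (r - m) := by
    intro φ hφ m r hr
    rcases hr.2.eq_or_lt with he | hlt
    · rw [he]
      have : Int.fract ((m : ℝ) + 1) = 0 := by
        rw [← Int.cast_one, ← Int.cast_add, Int.fract_intCast]
      rw [this, hφ]
      congr 1
      ring
    · have : ⌊r⌋ = m := Int.floor_eq_iff.2 ⟨hr.1, hlt⟩
      rw [Int.fract, this]
  set G : ℝ → ℝ := fun r => g (Int.fract r)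
  set Ψ : ℝ → ℝ := fun r => ψ (Int.fract r)
  have hunit : ∀ (m : ℤ), ∀ r ∈ Icc (m : ℝ) (m + 1), ∀ r' ∈ Icc (m : ℝ) (m + 1),
      |G r' - G r - Ψ r * (r' - r)| ≤ K * (r' - r) ^ 2 := by
    intro m r hr r' hr'
    have := h (r - m) ⟨by linarith [hr.1], by linarith [hr.2]⟩ (r' - m)
      ⟨by linarith [hr'.1], by linarith [hr'.2]⟩
    simp only [G, Ψ]
    rw [hper g hg m r hr, hper g hg m r' hr', hper ψ hψ m r hr]
    rwa [sub_sub_sub_cancel_right] at this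
  have hΨsub : ∀ r r', |G r' - G r - Ψ r * (r' - r)| ≤ K * (r' - r) ^ 2 →
      |G r - G r' - Ψ r' * (r - r')| ≤ K * (r - r') ^ 2 →
      |Ψ r' - Ψ r| ≤ 2 * K * |r' - r| := by
    intro r r' h1 h2
    rcases eq_or_ne r' r with rfl | hne
    · simp
    have hpos : 0 < |r' - r| := abs_pos.2 (sub_ne_zero.2 hne)
    refine le_of_mul_le_mul_right ?_ hpos
    rw [← abs_mul]
    have e : (Ψ r' - Ψ r) * (r' - r) =
        (G r' - G r - Ψ r * (r' - r)) + (G r - G r' - Ψ r' * (r - r')) := by ring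
    rw [e, mul_assoc, ← pow_two, sq_abs]
    refine (abs_add_le _ _).trans ?_
    nlinarith
  have hΨunit : ∀ (m : ℤ), ∀ r ∈ Icc (m : ℝ) (m + 1), ∀ r' ∈ Icc (m : ℝ) (m + 1),
      |Ψ r' - Ψ r| ≤ 2 * K * |r' - r| := fun m r hr r' hr' =>
    hΨsub r r' (hunit m r hr r' hr') (hunit m r' hr' r hr)
  -- Passing an intermediate point costs nothing: the two squares and the cross term from the
  -- Lipschitz bound on `Ψ` add up to exactly `K * (r' - r) ^ 2`.
  have hglue : ∀ r r' p, |G p - G r - Ψ r * (p - r)| ≤ K * (p - r) ^ 2 →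
      |G r' - G p - Ψ p * (r' - p)| ≤ K * (r' - p) ^ 2 → |Ψ p - Ψ r| ≤ 2 * K * |p - r| →
      0 ≤ (p - r) * (r' - p) → |G r' - G r - Ψ r * (r' - r)| ≤ K * (r' - r) ^ 2 := by
    intro r r' p h1 h2 h3 h4
    have e : G r' - G r - Ψ r * (r' - r) = (G p - G r - Ψ r * (p - r)) +
        (G r' - G p - Ψ p * (r' - p)) + (Ψ p - Ψ r) * (r' - p) := by ring
    have h5 : |(Ψ p - Ψ r) * (r' - p)| ≤ 2 * K * ((p - r) * (r' - p)) := by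
      rw [abs_mul, ← abs_of_nonneg h4, abs_mul, ← mul_assoc]
      exact mul_le_mul_of_nonneg_right h3 (abs_nonneg _)
    rw [e]
    refine ((abs_add_le _ _).trans (add_le_add (abs_add_le _ _) h5)).trans ?_
    nlinarith
  have hloc : ∀ r r', |r' - r| < 1 → |G r' - G r - Ψ r * (r' - r)| ≤ K * (r' - r) ^ 2 := by
    intro r r' hlt
    have hm : ((⌊r⌋ : ℝ)) ≤ r ∧ r < ⌊r⌋ + 1 := ⟨Int.floor_le r, Int.lt_floor_add_one r⟩
    set m := ⌊r⌋
    rw [abs_lt] at hlt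
    rcases lt_or_ge r' m with hr' | hr'
    · have h1 : r ∈ Icc (m : ℝ) (m + 1) := ⟨hm.1, hm.2.le⟩
      have h2 : (m : ℝ) ∈ Icc (m : ℝ) (m + 1) := ⟨le_rfl, by linarith⟩
      have h3 : (m : ℝ) ∈ Icc ((m - 1 : ℤ) : ℝ) ((m - 1 : ℤ) + 1) := by
        push_cast; constructor <;> linarith
      have h4 : r' ∈ Icc ((m - 1 : ℤ) : ℝ) ((m - 1 : ℤ) + 1) := by
        push_cast; constructor <;> linarith
      exact hglue r r' m (hunit m r h1 m h2) (hunit _ m h3 r' h4) (hΨunit m r h1 m h2)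
        (mul_nonneg_of_nonpos_of_nonpos (by linarith) (by linarith))
    rcases le_or_gt r' (m + 1) with hr'' | hr''
    · exact hunit m r ⟨hm.1, hm.2.le⟩ r' ⟨hr', hr''⟩
    · have h1 : r ∈ Icc (m : ℝ) (m + 1) := ⟨hm.1, hm.2.le⟩
      have h2 : (m : ℝ) + 1 ∈ Icc (m : ℝ) (m + 1) := ⟨by linarith, le_rfl⟩
      have h3 : (m : ℝ) + 1 ∈ Icc ((m + 1 : ℤ) : ℝ) ((m + 1 : ℤ) + 1) := by
        push_cast; constructor <;> linarith
      have h4 : r' ∈ Icc ((m + 1 : ℤ) : ℝ) ((m + 1 : ℤ) + 1) := by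
        push_cast; constructor <;> linarith
      exact hglue r r' (m + 1) (hunit m r h1 _ h2) (hunit _ _ h3 r' h4) (hΨunit m r h1 _ h2)
        (mul_nonneg (by linarith) (by linarith))
  refine ⟨fun r => ?_, fun r r' => ?_⟩
  · rw [hasDerivAt_iff_isLittleO]
    refine Asymptotics.IsBigO.trans_isLittleO (g := fun r' => ‖r' - r‖ ^ 2) ?_
      (Asymptotics.isLittleO_pow_sub_sub r one_lt_two)
    refine Asymptotics.IsBigO.of_bound K ?_
    filter_upwards [Metric.ball_mem_nhds r one_pos] with r' hr'
    have := hloc r r' (by rwa [Metric.mem_ball, Real.dist_eq] at hr')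
    simp only [Real.norm_eq_abs, sq_abs, abs_pow, smul_eq_mul]
    rwa [mul_comm (r' - r)]
  · rcases lt_or_ge |r' - r| 1 with hlt | hge
    · exact hΨsub r r' (hloc r r' hlt) (hloc r' r (by rwa [abs_sub_comm]))
    · have hf0 := Int.fract_nonneg (r' - r)
      have hf1 := Int.fract_lt_one (r' - r)
      -- Periodicity replaces a distant `r'` by a point at distance less than `1` from `r`.
      have e : Ψ r' = Ψ (r + Int.fract (r' - r)) := by
        have : r + Int.fract (r' - r) = r' - (⌊r' - r⌋ : ℤ) := by
          rw [Int.fract]; ring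
        simp only [Ψ]
        rw [this, Int.fract_sub_intCast]
      have hd : |r + Int.fract (r' - r) - r| < 1 := by
        rwa [add_sub_cancel_left, abs_of_nonneg hf0]
      change |Ψ r' - Ψ r| ≤ _
      rw [e]
      refine (hΨsub r _ (hloc r _ hd) (hloc _ r (by rwa [abs_sub_comm]))).trans
        (mul_le_mul_of_nonneg_left (hd.le.trans hge) (by positivity))

theorem isC1Lip_of_hasDerivAt {φ : UnitAddCircle × UnitAddCircle → ℝ} {G Ψ : ℝ → ℝ} {K : ℝ}
    (hφ : ∀ p : ℝ × ℝ, φ ((p.1 : UnitAddCircle), (p.2 : UnitAddCircle)) = G p.2)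
    (hG : ∀ r, HasDerivAt G (Ψ r) r) (hΨ : ∀ r r', |Ψ r' - Ψ r| ≤ K * |r' - r|) : IsC1Lip φ := by
  have hK : 0 ≤ K := by simpa using (abs_nonneg _).trans (hΨ 0 1)
  have hfd : ∀ p : ℝ × ℝ, HasFDerivAt (fun p : ℝ × ℝ => G p.2)
      (Ψ p.2 • ContinuousLinearMap.snd ℝ ℝ ℝ) p := fun p =>
    (hG p.2).comp_hasFDerivAt p hasFDerivAt_snd
  have hfe : fderiv ℝ (fun p : ℝ × ℝ => G p.2) =
      fun p => Ψ p.2 • ContinuousLinearMap.snd ℝ ℝ ℝ := funext fun p => (hfd p).fderiv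
  have hlip : LipschitzWith K.toNNReal (fderiv ℝ fun p : ℝ × ℝ => G p.2) := by
    rw [hfe]
    refine LipschitzWith.of_dist_le_mul fun p q => ?_
    have e : Ψ p.2 • ContinuousLinearMap.snd ℝ ℝ ℝ - Ψ q.2 • ContinuousLinearMap.snd ℝ ℝ ℝ =
        (Ψ p.2 - Ψ q.2) • ContinuousLinearMap.snd ℝ ℝ ℝ := by
      ext <;> simp
    rw [Real.coe_toNNReal K hK, dist_eq_norm, e, norm_smul]
    refine (mul_le_of_le_one_right (norm_nonneg _)
      (ContinuousLinearMap.norm_snd_le ℝ ℝ ℝ)).trans ((hΨ q.2 p.2).trans ?_)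
    rw [← Real.dist_eq]
    gcongr
    exact le_max_right _ _
  unfold IsC1Lip
  simp only [hφ]
  exact ⟨contDiff_one_iff_fderiv.2 ⟨fun p => (hfd p).differentiableAt, hlip.continuous⟩,
    _, hlip⟩

namespace IsBakerDrivenSystem

variable {a : ℝ} {f : UnitAddCircle → ℝ → ℝ} {s t s' t' : ℝ}
  (hf : IsBakerDrivenSystem a f s t s' t')

include hf

/-- Invariant Lipschitz curves over `J` are differentiable with quadratic remainder, and their
derivatives match at the end points. -/
theorem exists_derivative_of_invariant {g : ℝ → ℝ} {L : ℝ}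
    (hgL : ∀ r ∈ Icc (0 : ℝ) 1, ∀ r' ∈ Icc (0 : ℝ) 1, |g r' - g r| ≤ L * |r' - r|)
    (hgJ : ∀ r ∈ Icc (0 : ℝ) 1, g r ∈ Icc s' t')
    (hinv : ∀ b, ∀ r ∈ Icc (0 : ℝ) 1,
      g (branchShift a b + branchScale a b * r) = f (r : UnitAddCircle) (g r)) :
    g 0 = g 1 ∧ ∃ K : ℝ, ∃ ψ : ℝ → ℝ, ψ 0 = ψ 1 ∧
      ∀ r ∈ Icc (0 : ℝ) 1, ∀ r' ∈ Icc (0 : ℝ) 1,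
        |g r' - g r - ψ r * (r' - r)| ≤ K * (r' - r) ^ 2 := by
  have h0 := hf.a_pos
  have h1 := hf.a_lt_one
  have hz : (0 : ℝ) ∈ Icc (0 : ℝ) 1 := by simp
  have ho : (1 : ℝ) ∈ Icc (0 : ℝ) 1 := by simp
  have hone : ((1 : ℝ) : UnitAddCircle) = ((0 : ℝ) : UnitAddCircle) := by
    rw [AddCircle.coe_period, AddCircle.coe_zero]
  -- The point `a` is the image of `0` under one branch and of `1` under the other, and the fibre
  -- map over `0 = 1` is injective.
  have hg01 : g 0 = g 1 := by
    have e0 := hinv true 0 hz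
    have e1 := hinv false 1 ho
    simp only [branchShift, branchScale, if_true, Bool.false_eq_true, if_false, mul_zero, add_zero,
      mul_one, zero_add] at e0 e1
    rw [hone] at e1
    exact (hf.strictMono_fibre _).injective (e0.symm.trans e1)
  refine ⟨hg01, ?_⟩
  obtain ⟨c, hc, hd⟩ := hf.exists_branchScale_le_deriv
  obtain ⟨K, hK0, A, hK⟩ := hf.exists_fibre_taylor
  have hIcc : Icc (0 : ℝ) 1 ⊆ Icc (-1 : ℝ) 1 := Icc_subset_Icc_left (by norm_num)
  have hL : 0 ≤ L := by simpa using (abs_nonneg _).trans (hgL 0 hz 1 ho)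
  have hmax : ∀ r ∈ Icc (0 : ℝ) 1, ∀ r' ∈ Icc (0 : ℝ) 1, K * (max |r' - r| |g r' - g r|) ^ 2 ≤
      K * (1 + L) ^ 2 * (r' - r) ^ 2 := by
    intro r hr r' hr'
    rw [← sq_abs (r' - r), mul_assoc, ← mul_pow]
    have h2 := hgL r hr r' hr'
    have h3 : 0 ≤ L * |r' - r| := by positivity
    gcongr
    exact max_le (by linarith) (by linarith [abs_nonneg (r' - r)])
  obtain ⟨K', ψ, hψ⟩ := exists_derivative_of_functional_equation (g := g)
    (A := fun r => A r (g r)) (B := fun r => deriv (f (r : UnitAddCircle)) (g r))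
    (K := K * (1 + L) ^ 2) h0 h1 hc hgL (fun r hr => hd false _ _ (hgJ r hr)) (by
      intro r hr r' hr'
      have e := hinv false r hr
      have e' := hinv false r' hr'
      simp only [branchShift, branchScale, Bool.false_eq_true, if_false, zero_add] at e e'
      rw [e, e']
      exact (hK r (hIcc hr) r' (hIcc hr') _ (hgJ r hr) _ (hgJ r' hr')).2.trans
        (hmax r hr r' hr'))
  refine ⟨K', ψ, ?_, hψ⟩
  have hK'0 : 0 ≤ K' := by simpa using (abs_nonneg _).trans (hψ 0 hz 1 ho)
  set A₀ := A 0 (g 0)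
  set B₀ := deriv (f ((0 : ℝ) : UnitAddCircle)) (g 0)
  -- The invariance equation differentiated at an end point `e`. Both ends share `A₀` and `B₀`,
  -- because the expansion is made at `0` with increment `r' - e`.
  have hend : ∀ b, ∀ e ∈ Icc (0 : ℝ) 1, (e : UnitAddCircle) = ((0 : ℝ) : UnitAddCircle) →
      g e = g 0 → (∀ η : ℝ, 0 < η → η ≤ 1 → ∃ r' ∈ Icc (0 : ℝ) 1, |r' - e| = η) →
      ψ (branchShift a b + branchScale a b * e) * branchScale a b = A₀ + B₀ * ψ e := by
    intro b e he hce hge hη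
    have hb := branchScale_pos h0 h1 b
    have hbm : ∀ r ∈ Icc (0 : ℝ) 1, branchShift a b + branchScale a b * r ∈ Icc (0 : ℝ) 1 := by
      intro r hr
      have := branchShift_nonneg h0 b
      have := branchShift_add_branchScale_le h1 b
      have := mul_nonneg hb.le hr.1
      constructor
      · linarith
      · nlinarith [hr.2]
    set X := ψ (branchShift a b + branchScale a b * e) * branchScale a b - (A₀ + B₀ * ψ e) with hX
    set C := K' * branchScale a b ^ 2 + K * (1 + L) ^ 2 + |B₀| * K' with hC
    have hbound : ∀ r' ∈ Icc (0 : ℝ) 1, |X * (r' - e)| ≤ C * (r' - e) ^ 2 := by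
      intro r' hr'
      have t1 := hψ _ (hbm e he) _ (hbm r' hr')
      rw [hinv b r' hr', hinv b e he, add_sub_add_left_eq_sub, ← mul_sub] at t1
      have t2 := (hK 0 (by norm_num) (r' - e) ⟨by linarith [hr'.1, he.2], by linarith [hr'.2, he.1]⟩
        (g e) (hgJ e he) (g r') (hgJ r' hr')).2
      have hcd : ((r' - e : ℝ) : UnitAddCircle) = (r' : UnitAddCircle) := by
        rw [AddCircle.coe_sub, hce, AddCircle.coe_zero, sub_zero]
      rw [sub_zero] at t2
      have t2' := t2.trans (hmax e he r' hr')
      rw [hcd, ← hce, hge, hce] at t2'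
      have t3 := hψ e he r' hr'
      rw [hce, hge] at t1
      rw [hge] at t3
      have e1 : X * (r' - e) =
          (f (r' : UnitAddCircle) (g r') - f ((0 : ℝ) : UnitAddCircle) (g 0) -
            (A₀ * (r' - e) + B₀ * (g r' - g 0))) -
          (f (r' : UnitAddCircle) (g r') - f ((0 : ℝ) : UnitAddCircle) (g 0) -
            ψ (branchShift a b + branchScale a b * e) * (branchScale a b * (r' - e))) +
          B₀ * (g r' - g 0 - ψ e * (r' - e)) := by rw [hX]; ring
      have t4 : |B₀ * (g r' - g 0 - ψ e * (r' - e))| ≤ |B₀| * (K' * (r' - e) ^ 2) := by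
        rw [abs_mul]
        exact mul_le_mul_of_nonneg_left t3 (abs_nonneg _)
      rw [e1]
      refine ((abs_add_le _ _).trans (add_le_add ((abs_sub _ _).trans (add_le_add t2' t1))
        t4)).trans (le_of_eq ?_)
      rw [hC]; ring
    have hXle : ∀ η : ℝ, 0 < η → η ≤ 1 → |X| ≤ C * η := by
      intro η hη0 hη1
      obtain ⟨r', hr', hre⟩ := hη η hη0 hη1
      have := hbound r' hr'
      rw [abs_mul, ← sq_abs, hre, pow_two, ← mul_assoc] at this
      exact le_of_mul_le_mul_right this hη0
    have hC0 : 0 ≤ C := by positivity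
    have hX0 : X = 0 := by
      by_contra hne
      have hpos : 0 < |X| := abs_pos.2 hne
      have hmin : 0 < min 1 (|X| / (2 * (C + 1))) := by positivity
      have h5 := hXle _ hmin (min_le_left _ _)
      have h6 : C * min 1 (|X| / (2 * (C + 1))) ≤ |X| / 2 := by
        calc C * min 1 (|X| / (2 * (C + 1))) ≤ (C + 1) * (|X| / (2 * (C + 1))) := by
              gcongr
              · linarith
              · exact min_le_right _ _
          _ = |X| / 2 := by field_simp
      linarith
    linarith [hX]
  have hz' := fun b => hend b 0 hz rfl rfl fun η hη0 hη1 =>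
    ⟨η, ⟨hη0.le, hη1⟩, by rw [sub_zero, abs_of_pos hη0]⟩
  have ho' := fun b => hend b 1 ho hone hg01.symm fun η hη0 hη1 =>
    ⟨1 - η, ⟨by linarith, by linarith⟩, by rw [sub_sub_cancel_left, abs_neg, abs_of_pos hη0]⟩
  have z0 := hz' false
  have z1 := hz' true
  have o0 := ho' false
  have o1 := ho' true
  simp only [branchShift, branchScale, if_true, Bool.false_eq_true, if_false, mul_zero, add_zero,
    mul_one, zero_add, add_sub_cancel] at z0 z1 o0 o1
  have hBa : a < B₀ := by
    have := hd false ((0 : ℝ) : UnitAddCircle) (g 0) (hgJ 0 hz)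
    simp only [branchScale, Bool.false_eq_true, if_false] at this
    nlinarith
  -- Eliminating `A₀`, `ψ 0` and `ψ 1` from the four end point equations. The last factor is
  -- negative since `B₀ > a`, so `ψ a = 0`, which forces `ψ 0 = ψ 1 = 0`, or `a = 1/2`, where the
  -- equations give `ψ 0 = ψ 1` directly.
  have hprod : ψ a * (1 - a - a) * (a * (1 - a) - B₀) = 0 := by
    have y0 : ψ 0 * a = ψ a * (1 - a) := by linarith
    have y1 : ψ 1 * (1 - a) = ψ a * a := by linarith
    have y2 : (a - B₀) * ψ 0 = (1 - a - B₀) * ψ 1 := by linarith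
    linear_combination (1 - a) * a * y2 - (1 - a) * (a - B₀) * y0 + a * (1 - a - B₀) * y1
  have ha' : 0 < 1 - a := by linarith
  rcases mul_eq_zero.1 hprod with h2 | h2
  · rcases mul_eq_zero.1 h2 with h3 | h3
    · have e0 : ψ 0 * a = 0 := by rw [z0, ← z1, h3, zero_mul]
      have e1 : ψ 1 * (1 - a) = 0 := by rw [o1, ← o0, h3, zero_mul]
      rw [(mul_eq_zero.1 e0).resolve_right h0.ne', (mul_eq_zero.1 e1).resolve_right ha'.ne']
    · have e : 1 - a = a := by linarith
      rw [e] at z1 o1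
      exact mul_right_cancel₀ h0.ne' (by linarith)
  · nlinarith

end IsBakerDrivenSystem

/-! ### The main theorem -/

theorem mainTheorem5 (a : ℝ) (f : UnitAddCircle → ℝ → ℝ) (s t s' t' : ℝ)
    (hf : IsBakerDrivenSystem a f s t s' t')
    (hν : ∃ ν : MeasureTheory.Measure (UnitAddCircle × UnitAddCircle),
      IsGibbsMeasure a ν ∧ ν (pinchedSet a f) = 0) :
    pinchedGraphClosure a f = ∅ ∨
      ∃ φ : UnitAddCircle × UnitAddCircle → ℝ,
        IsC1Lip φ ∧ (∀ ξ ξ' x : UnitAddCircle, φ (ξ, x) = φ (ξ', x)) ∧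
        pinchedGraphClosure a f = Set.graphOn φ Set.univ := by
  obtain ⟨ν, hν, hP⟩ := hν
  obtain ⟨M, hM⟩ := hf.bounded
  have h0 := hf.a_pos
  have h1 := hf.a_lt_one
  set Q : Set UnitAddCircle := {x | upper a f M x = lower a f M x} with hQ
  have hPQ : pinchedSet a f = Prod.snd ⁻¹' Q := hf.pinchedSet_eq hM
  rcases Q.eq_empty_or_nonempty with hQe | ⟨x₀, hx₀⟩
  · left
    rw [pinchedGraphClosure, hPQ, hQe, preimage_empty, graphOn_empty, closure_empty]
  right
  obtain ⟨L, hL0, hL⟩ := hf.exists_lipschitz_upper hM hν hP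
  obtain ⟨g, hgL, hgE⟩ : ∃ g : ℝ → ℝ, LipschitzWith L.toNNReal g ∧
      EqOn (fun r : ℝ => upper a f M (r : UnitAddCircle)) g (circleCoord '' Q) := by
    -- The extension is made in the coordinate on `ℝ`, not on the circle: the Lipschitz bound is not
    -- yet known across `0`, and continuity there comes later from `g 0 = g 1`.
    refine LipschitzOnWith.extend_real (LipschitzOnWith.of_dist_le_mul ?_)
    rintro _ ⟨x, hx, rfl⟩ _ ⟨y, hy, rfl⟩
    rw [coe_circleCoord, coe_circleCoord, Real.coe_toNNReal L hL0, Real.dist_eq, Real.dist_eq,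
      abs_le]
    have hxy := hL x y hx hy
    rw [abs_sub_comm] at hxy
    exact ⟨by linarith, hL y x hy hx⟩
  have hgQ : ∀ x ∈ Q, g (circleCoord x) = upper a f M x := fun x hx => by
    have := hgE (mem_image_of_mem _ hx)
    simpa using this.symm
  have hgc : Continuous g := hgL.continuous
  have happrox : ∀ x : UnitAddCircle, ∀ ε > 0, ∃ z ∈ Q, |circleCoord x - circleCoord z| < ε := by
    intro x ε hε
    obtain ⟨N, hN⟩ := exists_max_pow_lt h0 h1 hε
    obtain ⟨ζ, hζ, z, hz⟩ := exists_branches_eq h0 h1 N x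
    refine ⟨branches a ζ x₀, hf.upper_eq_lower_branches hM hx₀ ζ, ?_⟩
    have := abs_circleCoord_branches_sub_le h0 h1 ζ z x₀
    rw [hz, hζ] at this
    exact this.trans_lt (hN N le_rfl)
  have hdense : Dense Q := fun x => Metric.mem_closure_iff.2 fun ε hε => by
    obtain ⟨z, hz, hd⟩ := happrox x ε hε
    exact ⟨z, hz, (dist_le_abs_circleCoord_sub x z).trans_lt hd⟩
  -- Density in the real interval including `1`, so that identities on `Q` pass to both end points.
  have hcl : Icc (0 : ℝ) 1 ⊆ closure (circleCoord '' Q) := by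
    rw [← closure_Ico zero_ne_one]
    refine closure_minimal (fun r hr => Metric.mem_closure_iff.2 fun ε hε => ?_) isClosed_closure
    obtain ⟨z, hz, hd⟩ := happrox (r : UnitAddCircle) ε hε
    rw [circleCoord_coe hr.1 hr.2, ← Real.dist_eq] at hd
    exact ⟨_, mem_image_of_mem _ hz, hd⟩
  have hgI : ∀ r ∈ Icc (0 : ℝ) 1, g r ∈ Icc s t := fun r hr => by
    refine closure_minimal ?_ (isClosed_Icc.preimage hgc) (hcl hr)
    rintro _ ⟨x, hx, rfl⟩
    rw [mem_preimage, hgQ x hx]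
    exact hf.upper_mem_of_eq hM hx
  have hinv : ∀ b, ∀ r ∈ Icc (0 : ℝ) 1,
      g (branchShift a b + branchScale a b * r) = f (r : UnitAddCircle) (g r) := by
    intro b r hr
    have hclosed : IsClosed {r : ℝ | g (branchShift a b + branchScale a b * r) =
        f (r : UnitAddCircle) (g r)} :=
      isClosed_eq (hgc.comp (by fun_prop))
        (hf.continuous_family.comp ((AddCircle.continuous_mk' (1 : ℝ)).prodMk hgc))
    refine closure_minimal ?_ hclosed (hcl hr)
    rintro _ ⟨x, hx, rfl⟩
    rw [mem_ofPred_eq, ← circleCoord_branch h0 h1, coe_circleCoord, hgQ x hx,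
      hgQ (branch a b x) (hf.upper_eq_lower_branches hM hx [b]), hf.upper_branch hM]
  obtain ⟨hg01, K, ψ, hψ01, hψ⟩ := hf.exists_derivative_of_invariant (L := L)
    (fun r _ r' _ => by
      have := hgL.dist_le_mul r' r
      rwa [Real.dist_eq, Real.dist_eq, Real.coe_toNNReal L hL0] at this)
    (fun r hr => hf.I_subset_J (hgI r hr)) hinv
  obtain ⟨hder, hlip⟩ := hasDerivAt_comp_fract hg01 hψ01 hψ
  have hφc : Continuous fun θ : UnitAddCircle × UnitAddCircle => g (circleCoord θ.2) :=
    (continuous_comp_circleCoord hg01 hgc.continuousOn).comp continuous_snd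
  refine ⟨fun θ => g (circleCoord θ.2), ?_, fun _ _ _ => rfl, ?_⟩
  · exact isC1Lip_of_hasDerivAt (fun p => by rw [circleCoord_coe_eq_fract]) hder hlip
  · have hPd : Dense (pinchedSet a f) := by
      rw [hPQ]
      exact hdense.preimage isOpenMap_snd
    have heq : EqOn (phiPlus a f) (fun θ => g (circleCoord θ.2)) (pinchedSet a f) := by
      intro θ hθ
      rw [hPQ] at hθ
      rw [hf.phiPlus_eq hM]
      exact (hgQ θ.2 hθ).symm
    have hgraph : (pinchedSet a f).graphOn (phiPlus a f) =
        (fun θ => (θ, g (circleCoord θ.2))) '' pinchedSet a f :=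
      image_congr fun θ hθ => by rw [heq hθ]
    rw [pinchedGraphClosure, hgraph]
    refine Subset.antisymm (closure_minimal ?_ ?_) ?_
    · rintro _ ⟨θ, -, rfl⟩
      exact ⟨θ, mem_univ _, rfl⟩
    · have : (univ : Set (UnitAddCircle × UnitAddCircle)).graphOn (fun θ => g (circleCoord θ.2)) =
          {p | g (circleCoord p.1.2) = p.2} := by
        ext p
        simp [mem_graphOn]
      rw [this]
      exact isClosed_eq (hφc.comp continuous_fst) continuous_snd
    · rintro _ ⟨θ, -, rfl⟩
      exact image_closure_subset_closure_image (continuous_id.prodMk hφc) ⟨θ, hPd θ, rfl⟩
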